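/- Let $\alpha>0$ and $b>1$ be fixed, and for each $n\in\mathbb{N}$ let $\mathcal{D}_n$ be a set of $\alpha$-log-Lipschitz distributions on $\{0,1\}^n$, i.e. distributions $D$ with $D(x)>0$ for all $x$ and $|\log D(x)-\log D(x')|\le\log\alpha$ whenever $x,x'$ differ in exactly one bit. A $k$-decision list is a list $(K_1,v_1),\dots,(K_r,v_r)$ where each $K_j$ is a conjunction of at most $k$ literals over $x_1,\dots,x_n$, $v_j\in\{0,1\}$ and $K_r=\mathtt{true}$; it maps $x$ to $v_j$ for the least $j$ such that $x$ satisfies $K_j$. It is monotone if all literals in its conjunctions are positive. The size of a function in a class of decision lists is the least size (number of nodes plus number of literal occurrences) of a list in that class computing it. For $h,c:\{0,1\}^n\to\{0,1\}$ and $\rho\ge 0$ let $\mathsf{R}^E_\rho(h,c)=\Pr_{x\sim D}[\exists z:\ d_H(x,z)\le\rho \text{ and } h(z)\ne c(z)]$, with $d_H$ the Hamming distance. A concept class $\mathcal{C}=(\mathcal{C}_n)_n$ is efficiently $\rho$-robustly learnable with respect to $\mathcal{D}=(\mathcal{D}_n)_n$, where $\rho:\mathbb{N}\to\mathbb{N}$,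 if there are an algorithm $\mathcal{A}$ and a polynomial $p$ in four variables such that for all $n$, all $c\in\mathcal{C}_n$, all $D\in\mathcal{D}_n$, all $\epsilon,\delta>0$ and all $m\ge p(n,1/\epsilon,1/\delta,\mathrm{size}(c))$, given $n$ and a sample $S\sim D^m$ labelled by $c$, $\mathcal{A}$ outputs a polynomially evaluatable $h:\{0,1\}^n\to\{0,1\}$ (given as a Boolean circuit of size polynomial in $n,1/\epsilon,1/\delta,\mathrm{size}(c)$) with $\Pr_{S\sim D^m}[\mathsf{R}^E_{\rho(n)}(h,c)<\epsilon]>1-\delta$. (So "efficiently" refers to polynomial sample complexity, and $h$ need not belong to $\mathcal{C}_n$.) Theorem. The class of 2-decision lists and, for every fixed $k$, the class of monotone $k$-decision lists are efficiently $\rho$-robustly learnable with respect to $\mathcal{D}$ for the robustness function $\rho(n)=\lfloor\log_b n\rfloor$ (with $\rho(0)=0$). -/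

import Mathlib

open MeasureTheory

noncomputable section

namespace RobustDL

/-- The boolean hypercube `{0,1}^n`, with Hamming distance `hammingDist`. -/
abbrev Cube (n : ℕ) : Type := Fin n → Bool

/-! ### Decision lists -/

/-- A conjunction of literals over `n` variables, given by its set of literals. The pair
`(i, true)` is the literal `x_i` and `(i, false)` is its negation; the empty set is `true`. -/
abbrev Term (n : ℕ) : Type := Finset (Fin n × Bool)

/-- `x ⊨ K`. -/
def Term.Sat {n : ℕ} (K : Term n) (x : Cube n) : Prop := ∀ l ∈ K, x l.1 = l.2

instance {n : ℕ} (K : Term n) (x : Cube n) : Decidable (K.Sat x) :=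
  inferInstanceAs (Decidable (∀ l ∈ K, x l.1 = l.2))

/-- A decision list `(K_1, v_1), …, (K_r, v_r)` with `K_r = true`: `nodes` holds the first `r - 1`
pairs and `last` is `v_r`. -/
structure DecisionList (n : ℕ) where
  nodes : List (Term n × Bool)
  last : Bool

/-- The value at the first node whose conjunction is true on `x`, and `v` if there is none. -/
def evalNodes {n : ℕ} : List (Term n × Bool) → Bool → Cube n → Bool
  | [], v, _ => v
  | (K, u) :: L, v, x => if K.Sat x then u else evalNodes L v x

/-- The function computed by a decision list. -/
def DecisionList.eval {n : ℕ} (L : DecisionList n) (x : Cube n) : Bool :=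
  evalNodes L.nodes L.last x

/-- `L` is a `k`-decision list: all conjunctions have at most `k` literals. -/
def DecisionList.IsK {n : ℕ} (k : ℕ) (L : DecisionList n) : Prop :=
  ∀ p ∈ L.nodes, p.1.card ≤ k

/-- `L` is monotone: all literals in its conjunctions are positive. -/
def DecisionList.IsMonotone {n : ℕ} (L : DecisionList n) : Prop :=
  ∀ p ∈ L.nodes, ∀ l ∈ p.1, l.2 = true

/-- The size of a decision list: its number of nodes plus its number of occurrences of literals. -/
def DecisionList.size {n : ℕ} (L : DecisionList n) : ℕ :=
  (L.nodes.map fun p => p.1.card + 1).sum + 1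

/-! ### Concept classes -/

/-- A family of classes of functions `{0,1}^n → {0,1}`, with a size for each concept. -/
structure ConceptClass where
  concepts : ∀ n, Set (Cube n → Bool)
  size : ∀ n, (Cube n → Bool) → ℕ

/-- The concept class represented by the decision lists in `R`: the functions that they compute,
where the size of a function is the least size of a representation of it in `R`. -/
def ConceptClass.ofLists (R : ∀ n, Set (DecisionList n)) : ConceptClass where
  concepts n := {c | ∃ L ∈ R n, L.eval = c}
  size n c := sInf {s | ∃ L ∈ R n, L.eval = c ∧ L.size = s}

/-- The class of `k`-decision lists. -/
def kDL (k : ℕ) : ConceptClass :=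
  ConceptClass.ofLists fun _ => {L | L.IsK k}

/-- The class of monotone `k`-decision lists. -/
def monotoneKDL (k : ℕ) : ConceptClass :=
  ConceptClass.ofLists fun _ => {L | L.IsK k ∧ L.IsMonotone}

/-! ### Distributions and robust risk -/

/-- `D` is `α`-log-Lipschitz: the logarithm of its probability mass function is
`log α`-Lipschitz for the Hamming distance. The first conjunct says that the logarithms are
finite. -/
def LogLipschitz {n : ℕ} (α : ℝ) (D : PMF (Cube n)) : Prop :=
  (∀ x, 0 < (D x).toReal) ∧
    ∀ x x' : Cube n, hammingDist x x' = 1 →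
      |Real.log (D x).toReal - Real.log (D x').toReal| ≤ Real.log α

/-- The exact-in-the-ball robust risk: the probability over `x ∼ D` that `h` and `c` differ at some
`z` in the Hamming ball of radius `ρ` around `x`. -/
def robustRisk {n : ℕ} (D : PMF (Cube n)) (ρ : ℕ) (h c : Cube n → Bool) : ℝ :=
  D.toMeasure.real {x | ∃ z, hammingDist x z ≤ ρ ∧ h z ≠ c z}

/-- The distribution `D^m` of `m` independent draws from `D`. -/
def sampleMeasure {n : ℕ} (D : PMF (Cube n)) (m : ℕ) : Measure (Fin m → Cube n) :=
  Measure.pi fun _ => D.toMeasure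

/-! ### Hypotheses: boolean circuits

A learner outputs its hypothesis as a boolean circuit, so that "polynomially evaluatable" means
that the circuit has polynomial size. -/

/-- A boolean circuit with NAND gates: each gate `(i, j)` computes the NAND of wires `i` and `j`,
and its value becomes the next wire. -/
abbrev Circuit : Type := List (ℕ × ℕ)

/-- The values of all wires, where `w` lists the values of the wires known so far (at the start,
the inputs). A wire that does not exist yet reads as the constant `false`. -/
def Circuit.wires : Circuit → List Bool → List Bool
  | [], w => w
  | g :: C, w => Circuit.wires C (w ++ [!(w.getD g.1 false && w.getD g.2 false)])

/-- The function computed by a circuit: the value of its last wire. -/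
def Circuit.eval (C : Circuit) {n : ℕ} (x : Cube n) : Bool :=
  (Circuit.wires C (List.ofFn x)).getLastD false

/-- The size of a circuit: its number of gates plus the number of bits needed to write down the
wires that they read. -/
def Circuit.size (C : Circuit) : ℕ :=
  (C.map fun g => 1 + g.1.size + g.2.size).sum

/-! ### Robust learning -/

/-- The sample `S` labelled by `c`, as data for a learner. -/
def labelled {n m : ℕ} (c : Cube n → Bool) (S : Fin m → Cube n) : List (List Bool × Bool) :=
  List.ofFn fun i => (List.ofFn (S i), c (S i))

/-- A learner maps the dimension and a list of labelled examples to a hypothesis. -/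
abbrev Learner : Type := ℕ × List (List Bool × Bool) → Circuit

/-- The value of `p` at `(n, 1/ε, 1/δ, s)`. -/
def polyAt (p : MvPolynomial (Fin 4) ℝ) (n : ℕ) (ε δ : ℝ) (s : ℕ) : ℝ :=
  MvPolynomial.eval ![(n : ℝ), 1 / ε, 1 / δ, (s : ℝ)] p

/-- The learner `A` efficiently `ρ`-robustly learns `𝒞` with respect to the distribution class `𝒟`:
there are polynomials `p`, `q` such that on `m ≥ p(n, 1/ε, 1/δ, size(c))` labelled examples `A`
outputs a hypothesis of size at most `q(n, 1/ε, 1/δ, size(c))`, which has robust risk less than `ε`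
with probability greater than `1 - δ`. -/
def EfficientlyRobustlyLearns (A : Learner) (𝒞 : ConceptClass) (𝒟 : ∀ n, Set (PMF (Cube n)))
    (ρ : ℕ → ℕ) : Prop :=
  ∃ p q : MvPolynomial (Fin 4) ℝ,
    ∀ n : ℕ, ∀ c ∈ 𝒞.concepts n, ∀ D ∈ 𝒟 n, ∀ ε δ : ℝ, 0 < ε → 0 < δ →
      ∀ m : ℕ, polyAt p n ε δ (𝒞.size n c) ≤ m →
        (∀ S : Fin m → Cube n,
          ((A (n, labelled c S)).size : ℝ) ≤ polyAt q n ε δ (𝒞.size n c)) ∧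
        1 - δ < (sampleMeasure D m).real
          {S | robustRisk D (ρ n) (A (n, labelled c S)).eval c < ε}

/-- `𝒞` is efficiently `ρ`-robustly learnable with respect to `𝒟`, by some algorithm, that is, a
computable learner. -/
def EfficientlyRobustlyLearnable (𝒞 : ConceptClass) (𝒟 : ∀ n, Set (PMF (Cube n)))
    (ρ : ℕ → ℕ) : Prop :=
  ∃ A : Learner, Computable A ∧ EfficientlyRobustlyLearns A 𝒞 𝒟 ρ

/-- The adversary's budget `log_b n`, rounded down (Hamming distances are integers). -/
def logBudget (b : ℝ) (n : ℕ) : ℕ := ⌊Real.logb b n⌋₊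

end RobustDL

end

namespace RobustDL

/-! ### Log-Lipschitz weights on the cube -/

section Weights

variable {n : ℕ} {α : ℝ} {w : Cube n → ℝ}

/-! For fixed `k`, the robust risk of one `k`-decision list against another is polynomially
controlled by its standard risk. It therefore suffices to find a consistent hypothesis. Both classes
of the theorem consist of `k`-decision lists, so one argument serves them.

The control comes from an expansion property of `k`-CNFs (`exists_pow_mass_nbhd_avoid_le`): if `P`
is the mass of the satisfying set and `Y` is the mass of its `ρ`-neighbourhood divided by `2 ^ ρ`,
then `Y ^ q ≤ P` with `q` depending only on `α` and `k`. Take a maximal family `M` of falsifying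
terms with pairwise disjoint variables. A point within `ρ` of the set satisfies at most `ρ` of them,
while log-Lipschitz weights make many of them hold typically; hence `Y ≤ θ ^ |M|` with `θ < 1`.
Fixing the variables of `M` shortens every clause, so induction on `k` gives `Y ^ q ≤ B ^ |M| * P`.
Multiplying by enough copies of the first bound absorbs `B ^ |M|`.

Two decision lists disagree on a union of boundedly many such CNFs, one for each pair of nodes with
different values (`exists_pow_robustRisk_le`). With `ρ = ⌊log_b n⌋` the loss `2 ^ ρ` is polynomial
in `n`. A greedy learner outputs a consistent list from a class whose log-cardinality is polynomial
in `n`, and a union bound (`lt_sampleMeasure_real_of_consistent`) makes its standard risk small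
enough. The list is then compiled to a NAND circuit. -/

lemma hammingDist_update_not (x : Cube n) (i : Fin n) :
    hammingDist (Function.update x i (!x i)) x = 1 := by
  unfold hammingDist
  rw [Finset.card_eq_one]
  refine ⟨i, ?_⟩
  ext j
  by_cases h : j = i
  · subst h; simp
  · simp [h]

/-- Flipping bit `i` maps one half of the cube onto the other, preserves `g` and changes `w` by a
factor of at most `α`. -/
lemma sum_le_half_cube (hw : ∀ x x', hammingDist x x' = 1 → w x ≤ α * w x')
    (i : Fin n) (c : Bool) {g : Cube n → ℝ} (hg0 : ∀ x, 0 ≤ g x)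
    (hg : ∀ x b, g (Function.update x i b) = g x) :
    ∑ x, w x * g x ≤ (1 + α) * ∑ x, if x i = c then w x * g x else 0 := by
  have hinv : Function.Involutive fun x : Cube n => Function.update x i (!x i) := by
    intro x
    simp
  have hsplit : ∑ x, w x * g x = (∑ x, if x i = c then w x * g x else 0) +
      ∑ x, if x i = c then 0 else w x * g x := by
    rw [← Finset.sum_add_distrib]
    refine Finset.sum_congr rfl fun x _ => ?_
    split_ifs <;> simp
  have hflip : ∑ x, (if x i = c then 0 else w x * g x) ≤
      α * ∑ x, if x i = c then w x * g x else 0 := by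
    rw [← Equiv.sum_comp hinv.toPerm, Finset.mul_sum]
    refine Finset.sum_le_sum fun x _ => ?_
    simp only [Function.Involutive.coe_toPerm, Function.update_self, hg]
    by_cases h : x i = c
    · have h' : ¬ (!x i) = c := by simp [h]
      rw [if_neg h', if_pos h, ← mul_assoc]
      exact mul_le_mul_of_nonneg_right (hw _ _ (hammingDist_update_not x i)) (hg0 x)
    · have h' : (!x i) = c := by cases hc : c <;> simp_all
      rw [if_pos h', if_neg h, mul_zero]
  linarith

lemma sum_le_subcube (hα : 0 ≤ α) (hw : ∀ x x', hammingDist x x' = 1 → w x ≤ α * w x')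
    (A : Finset (Fin n)) (a : Cube n) {g : Cube n → ℝ} (hg0 : ∀ x, 0 ≤ g x)
    (hg : ∀ i ∈ A, ∀ x b, g (Function.update x i b) = g x) :
    ∑ x, w x * g x ≤
      (1 + α) ^ A.card * ∑ x, if ∀ i ∈ A, x i = a i then w x * g x else 0 := by
  induction A using Finset.induction_on with
  | empty => simp
  | insert i A hi ih =>
    refine (ih fun j hj => hg j (Finset.mem_insert_of_mem hj)).trans ?_
    rw [Finset.card_insert_of_notMem hi, pow_succ, mul_assoc]
    refine mul_le_mul_of_nonneg_left ?_ (by positivity)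
    -- The constraints already imposed on `A` are absorbed into `g`; they do not involve `i`.
    have := sum_le_half_cube hw i (a i)
      (g := fun x => if ∀ j ∈ A, x j = a j then g x else 0)
      (fun x => by split_ifs <;> simp [hg0])
      (fun x b => by
        have : (∀ j ∈ A, Function.update x i b j = a j) ↔ ∀ j ∈ A, x j = a j := by
          refine forall₂_congr fun j hj => ?_
          rw [Function.update_of_ne (fun h : j = i => hi (h ▸ hj))]
        simp only [this, hg i (Finset.mem_insert_self i A)])
    refine le_trans (le_of_eq ?_) (this.trans (le_of_eq ?_))
    · exact Finset.sum_congr rfl fun x _ => by split_ifs <;> simp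
    · congr 1
      refine Finset.sum_congr rfl fun x _ => ?_
      by_cases h1 : x i = a i <;> by_cases h2 : ∀ j ∈ A, x j = a j <;>
        simp [h1, h2]

end Weights

/-! ### Terms and their variables -/

/-- The variables that occur in a term. -/
def Term.vars {n : ℕ} (K : Term n) : Finset (Fin n) := K.image Prod.fst

lemma Term.card_vars_le {n : ℕ} (K : Term n) : K.vars.card ≤ K.card := Finset.card_image_le

lemma Term.sat_congr {n : ℕ} {K : Term n} {x y : Cube n} (h : ∀ i ∈ K.vars, x i = y i) :
    K.Sat x ↔ K.Sat y :=
  forall₂_congr fun l hl => by rw [h l.1 (Finset.mem_image_of_mem _ hl)]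

/-- An exponential moment bound that replaces independence. The factor from the other terms does not
depend on the variables of `K`, so under the weight `w * g` the term `K` still holds on a fraction
of at least `(1 + α)⁻ᵏ`. Halving the weight there removes half of that fraction. -/
lemma sum_half_pow_card_sat_le {n : ℕ} {α : ℝ} {w : Cube n → ℝ} (hα : 0 ≤ α)
    (hw0 : ∀ x, 0 ≤ w x) (hw : ∀ x x', hammingDist x x' = 1 → w x ≤ α * w x') {k : ℕ}
    (M : Finset (Term n)) (hk : ∀ K ∈ M, K.card ≤ k) (hsat : ∀ K ∈ M, ∃ x, K.Sat x)
    (hdisj : ∀ K ∈ M, ∀ K' ∈ M, K ≠ K' → Disjoint K.vars K'.vars) :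
    ∑ x, w x * (1 / 2 : ℝ) ^ (M.filter fun K => K.Sat x).card ≤
      (1 - 1 / 2 * ((1 + α) ^ k)⁻¹) ^ M.card * ∑ x, w x := by
  induction M using Finset.induction_on with
  | empty => simp
  | insert K M hK ih =>
    have ih' := ih (fun L hL => hk L (Finset.mem_insert_of_mem hL))
      (fun L hL => hsat L (Finset.mem_insert_of_mem hL))
      (fun L hL L' hL' => hdisj L (Finset.mem_insert_of_mem hL) L' (Finset.mem_insert_of_mem hL'))
    set g : Cube n → ℝ := fun x => (1 / 2 : ℝ) ^ (M.filter fun K => K.Sat x).card with hgdef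
    have hg0 : ∀ x, 0 ≤ g x := fun x => by positivity
    obtain ⟨a, ha⟩ := hsat K (Finset.mem_insert_self _ _)
    have hinv : ∀ i ∈ K.vars, ∀ x b, g (Function.update x i b) = g x := by
      intro i hi x b
      simp only [hgdef]
      congr 2
      refine Finset.filter_congr fun L hL => Term.sat_congr fun j hj => ?_
      have hd := hdisj K (Finset.mem_insert_self _ _) L (Finset.mem_insert_of_mem hL)
        (fun h => hK (h ▸ hL))
      rw [Function.update_of_ne]
      rintro rfl
      exact Finset.disjoint_left.1 hd hi hj
    have h1 := sum_le_subcube hα hw K.vars a hg0 hinv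
    have hone : (1 : ℝ) ≤ 1 + α := by linarith
    have h2 : (∑ x, if ∀ i ∈ K.vars, x i = a i then w x * g x else 0) ≤
        ∑ x, if K.Sat x then w x * g x else 0 := by
      refine Finset.sum_le_sum fun x _ => ?_
      by_cases h : ∀ i ∈ K.vars, x i = a i
      · rw [if_pos h, if_pos ((Term.sat_congr h).2 ha)]
      · rw [if_neg h]
        split_ifs
        · exact mul_nonneg (hw0 x) (hg0 x)
        · exact le_rfl
    have h3 : (1 + α) ^ K.vars.card ≤ (1 + α) ^ k :=
      pow_le_pow_right₀ hone (K.card_vars_le.trans (hk K (Finset.mem_insert_self _ _)))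
    have hS0 : 0 ≤ ∑ x, if K.Sat x then w x * g x else 0 :=
      Finset.sum_nonneg fun x _ => by
        split_ifs
        · exact mul_nonneg (hw0 x) (hg0 x)
        · exact le_rfl
    have h4 : ((1 + α) ^ k)⁻¹ * ∑ x, w x * g x ≤ ∑ x, if K.Sat x then w x * g x else 0 := by
      rw [inv_mul_le_iff₀ (by positivity)]
      refine h1.trans ((mul_le_mul_of_nonneg_left h2 (by positivity)).trans ?_)
      exact mul_le_mul_of_nonneg_right h3 hS0
    have h5 : ∑ x, w x * (1 / 2 : ℝ) ^ ((insert K M).filter fun K => K.Sat x).card =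
        ∑ x, w x * g x - 1 / 2 * ∑ x, if K.Sat x then w x * g x else 0 := by
      rw [Finset.mul_sum, ← Finset.sum_sub_distrib]
      refine Finset.sum_congr rfl fun x _ => ?_
      rw [Finset.filter_insert]
      by_cases h : K.Sat x
      · rw [if_pos h, if_pos h, Finset.card_insert_of_notMem (by simp [hK]), pow_succ]
        ring
      · rw [if_neg h, if_neg h]
        ring
    have hθ : 0 ≤ 1 - 1 / 2 * ((1 + α) ^ k)⁻¹ := by
      have : ((1 + α) ^ k)⁻¹ ≤ 1 := inv_le_one_of_one_le₀ (one_le_pow₀ hone)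
      linarith
    rw [h5, Finset.card_insert_of_notMem hK, pow_succ', mul_assoc]
    refine le_trans ?_ (mul_le_mul_of_nonneg_left ih' hθ)
    linarith

/-! ### Expansion of the satisfying sets of `k`-CNFs -/

/-- The satisfying set of the CNF whose clauses are the negations of the terms in `Φ`. -/
def avoid {n : ℕ} (Φ : Finset (Term n)) : Set (Cube n) := {x | ∀ K ∈ Φ, ¬ K.Sat x}

/-- The set of points within Hamming distance `ρ` of `S`. -/
def nbhd {n : ℕ} (ρ : ℕ) (S : Set (Cube n)) : Set (Cube n) :=
  {x | ∃ z ∈ S, hammingDist x z ≤ ρ}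

/-- The total weight of a set. -/
noncomputable def mass {n : ℕ} (w : Cube n → ℝ) (E : Set (Cube n)) : ℝ := ∑ x, E.indicator w x

/-! ### Basic properties of the mass -/

section Mass

variable {n : ℕ} {w : Cube n → ℝ}

lemma mass_nonneg (hw0 : ∀ x, 0 ≤ w x) (E : Set (Cube n)) : 0 ≤ mass w E :=
  Finset.sum_nonneg fun x _ => Set.indicator_nonneg (fun y _ => hw0 y) x

lemma mass_mono (hw0 : ∀ x, 0 ≤ w x) {E F : Set (Cube n)} (h : E ⊆ F) : mass w E ≤ mass w F :=
  Finset.sum_le_sum fun x _ => Set.indicator_le_indicator_of_subset h hw0 x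

lemma mass_le_sum_of_subset {ι : Type*} (hw0 : ∀ x, 0 ≤ w x) (s : Finset ι)
    {E : Set (Cube n)} {F : ι → Set (Cube n)} (h : ∀ x ∈ E, ∃ i ∈ s, x ∈ F i) :
    mass w E ≤ ∑ i ∈ s, mass w (F i) := by
  unfold mass
  rw [Finset.sum_comm]
  refine Finset.sum_le_sum fun x _ => ?_
  by_cases hx : x ∈ E
  · obtain ⟨i, hi, hxi⟩ := h x hx
    rw [Set.indicator_of_mem hx, ← Set.indicator_of_mem hxi w]
    exact Finset.single_le_sum (f := fun i => (F i).indicator w x)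
      (fun j _ => Set.indicator_nonneg (fun y _ => hw0 y) x) hi
  · rw [Set.indicator_of_notMem hx]
    exact Finset.sum_nonneg fun j _ => Set.indicator_nonneg (fun y _ => hw0 y) x

end Mass

/-- The restriction of a CNF to the subcube on which the variables in `V` have the values `a`. -/
def restrictCNF {n : ℕ} (Φ : Finset (Term n)) (V : Finset (Fin n)) (a : Cube n) :
    Finset (Term n) :=
  open Classical in
  (Φ.filter fun K => (∃ x, K.Sat x) ∧ ∀ l ∈ K, l.1 ∈ V → a l.1 = l.2).image
    fun K => K.filter fun l => l.1 ∉ V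

/-! ### Restricting a CNF to a subcube -/

section Restrict

variable {n : ℕ} {Φ : Finset (Term n)} {V : Finset (Fin n)} {a : Cube n}

lemma mem_restrictCNF {L : Term n} : L ∈ restrictCNF Φ V a ↔ ∃ K ∈ Φ, (∃ x, K.Sat x) ∧
    (∀ l ∈ K, l.1 ∈ V → a l.1 = l.2) ∧ K.filter (fun l => l.1 ∉ V) = L := by
  simp only [restrictCNF, Finset.mem_image, Finset.mem_filter]
  constructor
  · rintro ⟨K, ⟨h1, h2, h3⟩, h4⟩
    exact ⟨K, h1, h2, h3, h4⟩
  · rintro ⟨K, h1, h2, h3, h4⟩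
    exact ⟨K, ⟨h1, h2, h3⟩, h4⟩

lemma mem_avoid_restrictCNF {z : Cube n} (hz : ∀ i ∈ V, z i = a i) :
    z ∈ avoid (restrictCNF Φ V a) ↔ z ∈ avoid Φ := by
  constructor
  · intro h K hK hs
    refine h _ (mem_restrictCNF.2 ⟨K, hK, ⟨z, hs⟩, fun l hl hV => ?_, rfl⟩) ?_
    · rw [← hz l.1 hV, hs l hl]
    · exact fun l hl => hs l (Finset.mem_of_mem_filter l hl)
  · intro h L hL hs
    obtain ⟨K, hK, -, hV, rfl⟩ := mem_restrictCNF.1 hL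
    refine h K hK fun l hl => ?_
    by_cases hlV : l.1 ∈ V
    · rw [hz l.1 hlV, hV l hl hlV]
    · exact hs l (Finset.mem_filter.2 ⟨hl, hlV⟩)

/-- The restricted CNF has no literals over `V`, so its satisfying set is a cylinder. This is the
invariance that `sum_le_subcube` requires. -/
lemma update_mem_avoid_restrictCNF {i : Fin n} (hi : i ∈ V) (x : Cube n) (b : Bool) :
    Function.update x i b ∈ avoid (restrictCNF Φ V a) ↔ x ∈ avoid (restrictCNF Φ V a) := by
  refine forall₂_congr fun L hL => not_congr (Term.sat_congr fun j hj => ?_)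
  obtain ⟨K, -, -, -, rfl⟩ := mem_restrictCNF.1 hL
  obtain ⟨l, hl, rfl⟩ := Finset.mem_image.1 hj
  rw [Function.update_of_ne]
  rintro rfl
  exact (Finset.mem_filter.1 hl).2 hi

/-- A cylinder over `V` weighs at most `(1 + α) ^ |V|` times its part in the subcube given by `a`,
and there it coincides with `avoid Φ`. -/
lemma mass_avoid_restrictCNF_le {α : ℝ} {w : Cube n → ℝ} (hα : 0 ≤ α) (hw0 : ∀ x, 0 ≤ w x)
    (hw : ∀ x x', hammingDist x x' = 1 → w x ≤ α * w x') :
    mass w (avoid (restrictCNF Φ V a)) ≤ (1 + α) ^ V.card * mass w (avoid Φ) := by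
  have h := sum_le_subcube hα hw V a
    (g := (avoid (restrictCNF Φ V a)).indicator fun _ => (1 : ℝ))
    (fun x => Set.indicator_nonneg (fun _ _ => zero_le_one) x)
    (fun i hi x b => by
      classical
      simp only [Set.indicator_apply, update_mem_avoid_restrictCNF hi])
  refine le_trans (le_of_eq ?_) (h.trans (mul_le_mul_of_nonneg_left ?_ (by positivity)))
  · refine Finset.sum_congr rfl fun x _ => ?_
    by_cases hx : x ∈ avoid (restrictCNF Φ V a) <;> simp [hx]
  · refine Finset.sum_le_sum fun x _ => ?_
    split_ifs with hx
    · have := mem_avoid_restrictCNF (Φ := Φ) hx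
      by_cases hx' : x ∈ avoid Φ
      · simp [hx', this.2 hx']
      · simp [hx', mt this.1 hx']
    · exact Set.indicator_nonneg (fun y _ => hw0 y) x

end Restrict

/-- Since `z` falsifies every term of `M`, each one true at `x` contains a variable where `x` and
`z` differ; disjointness makes these variables distinct. -/
lemma card_filter_sat_le_hammingDist {n : ℕ} {Φ M : Finset (Term n)} (hM : M ⊆ Φ)
    (hdisj : ∀ K ∈ M, ∀ K' ∈ M, K ≠ K' → Disjoint K.vars K'.vars) {x z : Cube n}
    (hz : z ∈ avoid Φ) : (M.filter fun K => K.Sat x).card ≤ hammingDist x z := by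
  have key : ∀ K ∈ M.filter fun K => K.Sat x, ∃ i ∈ K.vars, x i ≠ z i := by
    intro K hK
    obtain ⟨hKM, hKx⟩ := Finset.mem_filter.1 hK
    by_contra! hcon
    exact hz K (hM hKM) ((Term.sat_congr hcon).1 hKx)
  rcases (M.filter fun K => K.Sat x).eq_empty_or_nonempty with h | ⟨K₀, hK₀⟩
  · simp [h]
  have : Nonempty (Fin n) := ⟨(key K₀ hK₀).choose⟩
  choose! f hf using key
  refine Finset.card_le_card_of_injOn f (fun K hK => ?_) fun K hK K' hK' he => ?_
  · simpa using (hf K hK).2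
  · by_contra hne
    exact Finset.disjoint_left.1 (hdisj K (Finset.mem_filter.1 hK).1 K'
      (Finset.mem_filter.1 hK').1 hne) (hf K hK).1 (he ▸ (hf K' hK').1)

/-- If a restricted term still had `k + 1` literals, the original satisfiable term would share no
variable with `M` and could be added to it. -/
lemma exists_maximal_disjoint_terms {n k : ℕ} (Φ : Finset (Term n))
    (hΦ : ∀ K ∈ Φ, K.card ≤ k + 1) :
    ∃ M ⊆ Φ, (∀ K ∈ M, ∃ x, K.Sat x) ∧
      (∀ K ∈ M, ∀ K' ∈ M, K ≠ K' → Disjoint K.vars K'.vars) ∧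
      ∀ a, ∀ L ∈ restrictCNF Φ (M.biUnion Term.vars) a, L.card ≤ k := by
  classical
  let P : Finset (Term n) → Prop := fun M => (∀ K ∈ M, ∃ x, K.Sat x) ∧
      ∀ K ∈ M, ∀ K' ∈ M, K ≠ K' → Disjoint K.vars K'.vars
  obtain ⟨M, hM, hmax⟩ := Finset.exists_max_image (Φ.powerset.filter P) Finset.card
    ⟨∅, by simp [P]⟩
  obtain ⟨hMΦ, hMsat, hMdisj⟩ := Finset.mem_filter.1 hM
  rw [Finset.mem_powerset] at hMΦ
  refine ⟨M, hMΦ, hMsat, hMdisj, fun a L hL => ?_⟩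
  obtain ⟨K, hK, hsat, -, rfl⟩ := mem_restrictCNF.1 hL
  by_contra! hcard
  have heq : K.filter (fun l => l.1 ∉ M.biUnion Term.vars) = K :=
    Finset.eq_of_subset_of_card_le (Finset.filter_subset _ _) ((hΦ K hK).trans hcard)
  rw [heq] at hcard
  have hout : ∀ l ∈ K, l.1 ∉ M.biUnion Term.vars := Finset.filter_eq_self.1 heq
  have hKM : K ∉ M := by
    intro h
    obtain ⟨l, hl⟩ := Finset.card_pos.1 (by omega : 0 < K.card)
    exact hout l hl (Finset.mem_biUnion.2 ⟨K, h, Finset.mem_image_of_mem _ hl⟩)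
  have hKdisj : ∀ K' ∈ M, Disjoint K.vars K'.vars := by
    intro K' hK'
    rw [Finset.disjoint_left]
    intro i hi hi'
    obtain ⟨l, hl, rfl⟩ := Finset.mem_image.1 hi
    exact hout l hl (Finset.mem_biUnion.2 ⟨K', hK', hi'⟩)
  have := hmax (insert K M) <| by
    refine Finset.mem_filter.2 ⟨Finset.mem_powerset.2 (Finset.insert_subset hK hMΦ), ?_, ?_⟩
    · intro K' hK'
      rcases Finset.mem_insert.1 hK' with rfl | h
      exacts [hsat, hMsat _ h]
    · intro K₁ h₁ K₂ h₂ hne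
      rcases Finset.mem_insert.1 h₁ with e₁ | m₁ <;> rcases Finset.mem_insert.1 h₂ with e₂ | m₂
      · exact absurd (e₁.trans e₂.symm) hne
      · exact e₁ ▸ hKdisj _ m₂
      · exact e₂ ▸ (hKdisj _ m₁).symm
      · exact hMdisj _ m₁ _ m₂ hne
  rw [Finset.card_insert_of_notMem hKM] at this
  omega

/-- Markov's inequality: on the neighbourhood at most `ρ` terms of `M` hold, so the function
averaged in `sum_half_pow_card_sat_le` is at least `2⁻ᵖ` there, with `p = ρ`. -/
lemma mass_nbhd_avoid_le_of_disjoint {n k : ℕ} {α : ℝ} {w : Cube n → ℝ} (hα : 0 ≤ α)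
    (hw0 : ∀ x, 0 ≤ w x) (hw : ∀ x x', hammingDist x x' = 1 → w x ≤ α * w x')
    (hw1 : ∑ x, w x ≤ 1) {Φ M : Finset (Term n)} (hM : M ⊆ Φ) (hk : ∀ K ∈ M, K.card ≤ k)
    (hsat : ∀ K ∈ M, ∃ x, K.Sat x)
    (hdisj : ∀ K ∈ M, ∀ K' ∈ M, K ≠ K' → Disjoint K.vars K'.vars) (ρ : ℕ) :
    mass w (nbhd ρ (avoid Φ)) / 2 ^ ρ ≤ (1 - 1 / 2 * ((1 + α) ^ k)⁻¹) ^ M.card := by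
  have hone : (1 : ℝ) ≤ 1 + α := by linarith
  have hθ : 0 ≤ 1 - 1 / 2 * ((1 + α) ^ k)⁻¹ := by
    have : ((1 + α) ^ k)⁻¹ ≤ 1 := inv_le_one_of_one_le₀ (one_le_pow₀ hone)
    linarith
  have h := sum_half_pow_card_sat_le hα hw0 hw M hk hsat hdisj
  have h' := h.trans (mul_le_of_le_one_right (pow_nonneg hθ _) hw1)
  refine le_trans ?_ h'
  rw [mass, Finset.sum_div]
  refine Finset.sum_le_sum fun x _ => ?_
  by_cases hx : x ∈ nbhd ρ (avoid Φ)
  · obtain ⟨z, hz, hd⟩ := id hx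
    rw [Set.indicator_of_mem hx, div_eq_mul_inv, ← inv_pow, ← one_div]
    exact mul_le_mul_of_nonneg_left (pow_le_pow_of_le_one (by norm_num) (by norm_num)
      ((card_filter_sat_le_hammingDist hM hdisj hz).trans hd)) (hw0 x)
  · rw [Set.indicator_of_notMem hx, zero_div]
    exact mul_nonneg (hw0 x) (by positivity)

/-- Pigeonhole over the `2 ^ |V|` assignments to `V`: the witness `z` near `x` agrees with one of
them and satisfies that restriction. The point `x` itself need not lie in the subcube. -/
lemma exists_restrictCNF_mass_le {n : ℕ} {w : Cube n → ℝ} (hw0 : ∀ x, 0 ≤ w x)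
    (Φ : Finset (Term n)) (V : Finset (Fin n)) (ρ : ℕ) :
    ∃ a, mass w (nbhd ρ (avoid Φ)) ≤
      2 ^ V.card * mass w (nbhd ρ (avoid (restrictCNF Φ V a))) := by
  let c : Finset (Fin n) → Cube n := fun W i => decide (i ∈ W)
  obtain ⟨W, -, hmax⟩ := Finset.exists_max_image V.powerset
    (fun W => mass w (nbhd ρ (avoid (restrictCNF Φ V (c W))))) ⟨∅, by simp⟩
  refine ⟨c W, ?_⟩
  refine (mass_le_sum_of_subset hw0 V.powerset
    (F := fun W => nbhd ρ (avoid (restrictCNF Φ V (c W)))) ?_).trans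
    ((Finset.sum_le_card_nsmul _ _ _ hmax).trans (le_of_eq ?_))
  · rintro x ⟨z, hz, hd⟩
    refine ⟨V.filter fun i => z i = true, by simp, z, ?_, hd⟩
    refine (mem_avoid_restrictCNF fun i hi => ?_).2 hz
    simp only [c, Finset.mem_filter, hi, true_and]
    cases z i <;> simp
  · rw [Finset.card_powerset, nsmul_eq_mul]
    push_cast
    rfl

theorem exists_pow_mass_nbhd_avoid_le {α : ℝ} (hα : 0 ≤ α) (k : ℕ) :
    ∃ q : ℕ, q ≠ 0 ∧ ∀ (n : ℕ) (w : Cube n → ℝ), (∀ x, 0 ≤ w x) →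
      (∀ x x', hammingDist x x' = 1 → w x ≤ α * w x') → ∑ x, w x ≤ 1 →
      ∀ Φ : Finset (Term n), (∀ K ∈ Φ, K.card ≤ k) → ∀ ρ : ℕ,
        (mass w (nbhd ρ (avoid Φ)) / 2 ^ ρ) ^ q ≤ mass w (avoid Φ) := by
  have hone : (1 : ℝ) ≤ 1 + α := by linarith
  induction k with
  | zero =>
    refine ⟨1, one_ne_zero, fun n w hw0 hw hw1 Φ hΦ ρ => ?_⟩
    rw [pow_one]
    have hle : mass w (nbhd ρ (avoid Φ)) ≤ mass w (avoid Φ) := by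
      -- A term of size `0` is always true, so the satisfying set is empty or the whole cube, and
      -- taking a neighbourhood adds nothing.
      refine mass_mono hw0 ?_
      rintro x ⟨z, hz, -⟩ K hK
      have : K = ∅ := Finset.card_eq_zero.1 (Nat.le_zero.1 (hΦ K hK))
      subst this
      exact absurd (fun l hl => absurd hl (Finset.notMem_empty l)) (hz _ hK)
    exact (div_le_self (mass_nonneg hw0 _) (one_le_pow₀ one_le_two)).trans hle
  | succ k ih =>
    obtain ⟨q, hq, ih⟩ := ih
    set θ : ℝ := 1 - 1 / 2 * ((1 + α) ^ (k + 1))⁻¹ with hθdef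
    set B : ℝ := (2 ^ q * (1 + α)) ^ (k + 1) with hBdef
    have hinv : 0 < ((1 + α) ^ (k + 1))⁻¹ := by positivity
    have hinv1 : ((1 + α) ^ (k + 1))⁻¹ ≤ 1 := inv_le_one_of_one_le₀ (one_le_pow₀ hone)
    have hθ0 : 0 ≤ θ := by rw [hθdef]; linarith
    have hθ1 : θ < 1 := by rw [hθdef]; linarith
    have hB : 0 < B := by positivity
    -- `B` is the price per term of `M` in the restriction argument; `e` copies of the decay `θ` pay
    -- for it.
    obtain ⟨e, he⟩ := exists_pow_lt_of_lt_one (inv_pos.2 hB) hθ1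
    have heB : B * θ ^ e ≤ 1 := by
      rw [mul_comm, ← le_div_iff₀ hB, one_div]
      exact he.le
    refine ⟨q + e, by omega, fun n w hw0 hw hw1 Φ hΦ ρ => ?_⟩
    obtain ⟨M, hMΦ, hsat, hdisj, hrestr⟩ := exists_maximal_disjoint_terms Φ hΦ
    have hY0 : 0 ≤ mass w (nbhd ρ (avoid Φ)) / 2 ^ ρ :=
      div_nonneg (mass_nonneg hw0 _) (by positivity)
    have hP0 : 0 ≤ mass w (avoid Φ) := mass_nonneg hw0 _
    have hmany := mass_nbhd_avoid_le_of_disjoint hα hw0 hw hw1 hMΦ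
      (fun K hK => hΦ K (hMΦ hK)) hsat hdisj ρ
    set V := M.biUnion Term.vars with hV
    have hVcard : V.card ≤ (k + 1) * M.card := by
      rw [mul_comm]
      exact Finset.card_biUnion_le_card_mul _ _ _ fun K hK =>
        K.card_vars_le.trans (hΦ K (hMΦ hK))
    obtain ⟨a, ha⟩ := exists_restrictCNF_mass_le hw0 Φ V ρ
    have hfew : (mass w (nbhd ρ (avoid Φ)) / 2 ^ ρ) ^ q ≤ B ^ M.card * mass w (avoid Φ) := by
      calc (mass w (nbhd ρ (avoid Φ)) / 2 ^ ρ) ^ q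
          ≤ (2 ^ V.card * (mass w (nbhd ρ (avoid (restrictCNF Φ V a))) / 2 ^ ρ)) ^ q := by
            refine pow_le_pow_left₀ hY0 ?_ q
            rw [← mul_div_assoc]
            gcongr
        _ = (2 ^ q) ^ V.card * (mass w (nbhd ρ (avoid (restrictCNF Φ V a))) / 2 ^ ρ) ^ q := by
            rw [mul_pow, ← pow_mul, ← pow_mul, mul_comm q]
        _ ≤ (2 ^ q) ^ V.card * ((1 + α) ^ V.card * mass w (avoid Φ)) := by
            gcongr
            exact (ih n w hw0 hw hw1 _ (hrestr a) ρ).trans (mass_avoid_restrictCNF_le hα hw0 hw)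
        _ = (2 ^ q * (1 + α)) ^ V.card * mass w (avoid Φ) := by rw [mul_pow, mul_assoc]
        _ ≤ (2 ^ q * (1 + α)) ^ ((k + 1) * M.card) * mass w (avoid Φ) := by
            refine mul_le_mul_of_nonneg_right (pow_le_pow_right₀ ?_ hVcard) hP0
            exact one_le_mul_of_one_le_of_one_le (one_le_pow₀ one_le_two) hone
        _ = B ^ M.card * mass w (avoid Φ) := by rw [pow_mul]
    -- Multiplying the two bounds avoids a case distinction on the size of `M`.
    calc (mass w (nbhd ρ (avoid Φ)) / 2 ^ ρ) ^ (q + e)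
        = (mass w (nbhd ρ (avoid Φ)) / 2 ^ ρ) ^ q * (mass w (nbhd ρ (avoid Φ)) / 2 ^ ρ) ^ e :=
          pow_add _ _ _
      _ ≤ (B ^ M.card * mass w (avoid Φ)) * (θ ^ M.card) ^ e :=
          mul_le_mul hfew (pow_le_pow_left₀ hY0 hmany e) (pow_nonneg hY0 e) (by positivity)
      _ = (B * θ ^ e) ^ M.card * mass w (avoid Φ) := by
          rw [mul_pow, pow_right_comm θ]; ring
      _ ≤ 1 * mass w (avoid Φ) :=
          mul_le_mul_of_nonneg_right (pow_le_one₀ (by positivity) heB) hP0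
      _ = mass w (avoid Φ) := one_mul _

/-! ### The regions of a decision list are CNFs -/

/-- The CNF whose clauses are the literals of `K`. -/
def Term.toCNF {n : ℕ} (K : Term n) : Finset (Term n) := K.image fun l => {(l.1, !l.2)}

lemma Term.mem_avoid_toCNF {n : ℕ} {K : Term n} {x : Cube n} :
    x ∈ avoid K.toCNF ↔ K.Sat x := by
  simp only [avoid, Set.mem_ofPred_eq, Term.toCNF, Finset.forall_mem_image]
  refine forall₂_congr fun l hl => ?_
  unfold Term.Sat
  simp only [Finset.mem_singleton, forall_eq]
  cases x l.1 <;> cases l.2 <;> simp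

/-- The regions on which the nodes of a decision list are active, as CNFs, with their values. -/
def regions {n : ℕ} : List (Term n × Bool) → Bool → List (Finset (Term n) × Bool)
  | [], v => [(∅, v)]
  | (K, u) :: L, v => (K.toCNF, u) :: (regions L v).map fun p => (insert K p.1, p.2)

section Regions

variable {n : ℕ}

lemma length_regions (L : List (Term n × Bool)) (v : Bool) :
    (regions L v).length = L.length + 1 := by
  induction L with
  | nil => rfl
  | cons p L ih => simp [regions, ih]

/-- The bound is `k + 1` because `Term.toCNF` produces singletons, which exceed `k` when `k = 0`. -/
lemma card_le_of_mem_regions {k : ℕ} {L : List (Term n × Bool)} (hL : ∀ p ∈ L, p.1.card ≤ k)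
    (v : Bool) : ∀ p ∈ regions L v, ∀ K ∈ p.1, K.card ≤ k + 1 := by
  induction L with
  | nil => simp [regions]
  | cons a L ih =>
    intro p hp K hK
    rcases List.mem_cons.1 hp with rfl | hp
    · obtain ⟨l, -, rfl⟩ := Finset.mem_image.1 hK
      simp
    · obtain ⟨p', hp', rfl⟩ := List.mem_map.1 hp
      rcases Finset.mem_insert.1 hK with rfl | hK
      · exact (hL a List.mem_cons_self).trans (Nat.le_succ k)
      · exact ih (fun p hp => hL p (List.mem_cons_of_mem _ hp)) p' hp' K hK

lemma mem_avoid_insert {Φ : Finset (Term n)} {K : Term n} {x : Cube n} :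
    x ∈ avoid (insert K Φ) ↔ ¬ K.Sat x ∧ x ∈ avoid Φ :=
  Finset.forall_mem_insert _ _ _

lemma exists_region (L : List (Term n × Bool)) (v : Bool) (x : Cube n) :
    ∃ p ∈ regions L v, x ∈ avoid p.1 ∧ evalNodes L v x = p.2 := by
  induction L with
  | nil => exact ⟨(∅, v), by simp [regions], by simp [avoid], rfl⟩
  | cons a L ih =>
    by_cases h : a.1.Sat x
    · exact ⟨(a.1.toCNF, a.2), List.mem_cons_self, Term.mem_avoid_toCNF.2 h, if_pos h⟩
    · obtain ⟨p, hp, hx, he⟩ := ih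
      exact ⟨(insert a.1 p.1, p.2), List.mem_cons_of_mem _ (List.mem_map.2 ⟨p, hp, rfl⟩),
        mem_avoid_insert.2 ⟨h, hx⟩, (if_neg h).trans he⟩

lemma evalNodes_of_mem_region {L : List (Term n × Bool)} {v : Bool} {x : Cube n} :
    ∀ p ∈ regions L v, x ∈ avoid p.1 → evalNodes L v x = p.2 := by
  induction L with
  | nil => simp [regions, evalNodes]
  | cons a L ih =>
    intro p hp hx
    rcases List.mem_cons.1 hp with rfl | hp
    · exact if_pos (Term.mem_avoid_toCNF.1 hx)
    · obtain ⟨p', hp', rfl⟩ := List.mem_map.1 hp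
      obtain ⟨h1, h2⟩ := mem_avoid_insert.1 hx
      exact (if_neg h1).trans (ih p' hp' h2)

lemma avoid_union {Φ Ψ : Finset (Term n)} {x : Cube n} :
    x ∈ avoid (Φ ∪ Ψ) ↔ x ∈ avoid Φ ∧ x ∈ avoid Ψ :=
  Finset.forall_mem_union

end Regions

/-- The disagreement set is the union, over pairs of regions with different values, of their
intersections, which are `(k + 1)`-CNFs. The pair with the heaviest neighbourhood accounts for the
whole up to the number of pairs. -/
theorem exists_pow_mass_nbhd_disagreement_le {α : ℝ} (hα : 0 ≤ α) (k : ℕ) :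
    ∃ q : ℕ, q ≠ 0 ∧ ∀ (n : ℕ) (w : Cube n → ℝ), (∀ x, 0 ≤ w x) →
      (∀ x x', hammingDist x x' = 1 → w x ≤ α * w x') → ∑ x, w x ≤ 1 →
      ∀ (L L' : List (Term n × Bool)) (v v' : Bool), (∀ p ∈ L, p.1.card ≤ k) →
        (∀ p ∈ L', p.1.card ≤ k) → ∀ ρ : ℕ,
        (mass w (nbhd ρ {x | evalNodes L v x ≠ evalNodes L' v' x}) /
          (2 ^ ρ * ((L.length + 1) * (L'.length + 1)))) ^ q ≤
            mass w {x | evalNodes L v x ≠ evalNodes L' v' x} := by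
  obtain ⟨q, hq, H⟩ := exists_pow_mass_nbhd_avoid_le hα (k + 1)
  refine ⟨q, hq, fun n w hw0 hw hw1 L L' v v' hL hL' ρ => ?_⟩
  set E : Set (Cube n) := {x | evalNodes L v x ≠ evalNodes L' v' x} with hE
  set s := ((regions L v).toFinset ×ˢ (regions L' v').toFinset).filter
    fun p => p.1.2 ≠ p.2.2 with hs
  have hcard : (s.card : ℝ) ≤ (L.length + 1) * (L'.length + 1) := by
    have h1 : s.card ≤ (L.length + 1) * (L'.length + 1) := by
      refine (Finset.card_filter_le _ _).trans ?_
      rw [Finset.card_product]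
      exact Nat.mul_le_mul ((List.toFinset_card_le _).trans (length_regions L v).le)
        ((List.toFinset_card_le _).trans (length_regions L' v').le)
    exact_mod_cast h1
  have hmem : ∀ p ∈ s, p.1 ∈ regions L v ∧ p.2 ∈ regions L' v' ∧ p.1.2 ≠ p.2.2 := by
    intro p hp
    obtain ⟨h1, h2⟩ := Finset.mem_filter.1 hp
    obtain ⟨h3, h4⟩ := Finset.mem_product.1 h1
    exact ⟨List.mem_toFinset.1 h3, List.mem_toFinset.1 h4, h2⟩
  have hcover : mass w (nbhd ρ E) ≤ ∑ p ∈ s, mass w (nbhd ρ (avoid (p.1.1 ∪ p.2.1))) := by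
    refine mass_le_sum_of_subset hw0 s (F := fun p => nbhd ρ (avoid (p.1.1 ∪ p.2.1))) ?_
    rintro x ⟨z, hz, hd⟩
    obtain ⟨p, hp, hzp, he⟩ := exists_region L v z
    obtain ⟨p', hp', hzp', he'⟩ := exists_region L' v' z
    refine ⟨(p, p'), Finset.mem_filter.2 ⟨Finset.mem_product.2
      ⟨List.mem_toFinset.2 hp, List.mem_toFinset.2 hp'⟩, ?_⟩, z, avoid_union.2 ⟨hzp, hzp'⟩, hd⟩
    rw [← he, ← he']
    exact hz
  rcases s.eq_empty_or_nonempty with hempty | hne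
  · rw [hempty, Finset.sum_empty] at hcover
    rw [le_antisymm hcover (mass_nonneg hw0 _), zero_div, zero_pow hq]
    exact mass_nonneg hw0 _
  · obtain ⟨p, hp, hmax⟩ := Finset.exists_max_image s
      (fun p => mass w (nbhd ρ (avoid (p.1.1 ∪ p.2.1)))) hne
    obtain ⟨hp1, hp2, hpne⟩ := hmem p hp
    have hle : mass w (nbhd ρ E) ≤ ((L.length + 1) * (L'.length + 1)) *
        mass w (nbhd ρ (avoid (p.1.1 ∪ p.2.1))) := by
      refine hcover.trans ((Finset.sum_le_card_nsmul _ _ _ hmax).trans ?_)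
      rw [nsmul_eq_mul]
      exact mul_le_mul_of_nonneg_right hcard (mass_nonneg hw0 _)
    have hsub : avoid (p.1.1 ∪ p.2.1) ⊆ E := by
      intro x hx
      obtain ⟨h1, h2⟩ := avoid_union.1 hx
      rw [hE, Set.mem_ofPred_eq, evalNodes_of_mem_region p.1 hp1 h1,
        evalNodes_of_mem_region p.2 hp2 h2]
      exact hpne
    have hk : ∀ K ∈ p.1.1 ∪ p.2.1, K.card ≤ k + 1 := by
      intro K hK
      rcases Finset.mem_union.1 hK with h | h
      · exact card_le_of_mem_regions hL v _ hp1 K h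
      · exact card_le_of_mem_regions hL' v' _ hp2 K h
    refine le_trans ?_ ((H n w hw0 hw hw1 _ hk ρ).trans (mass_mono hw0 hsub))
    refine pow_le_pow_left₀ (div_nonneg (mass_nonneg hw0 _) (by positivity)) ?_ q
    rw [div_le_div_iff₀ (by positivity) (by positivity)]
    calc mass w (nbhd ρ E) * 2 ^ ρ
        ≤ (((L.length + 1) * (L'.length + 1)) *
          mass w (nbhd ρ (avoid (p.1.1 ∪ p.2.1)))) * 2 ^ ρ := by gcongr
      _ = _ := by ring

/-! ### Robust risk and standard risk -/

lemma sum_toReal_eq_one {n : ℕ} (D : PMF (Cube n)) : ∑ x, (D x).toReal = 1 := by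
  have h := D.tsum_coe
  rw [tsum_fintype] at h
  rw [← ENNReal.toReal_sum fun x _ => D.apply_ne_top x, h, ENNReal.toReal_one]

lemma toMeasure_real_eq_mass {n : ℕ} (D : PMF (Cube n)) (E : Set (Cube n)) :
    D.toMeasure.real E = mass (fun x => (D x).toReal) E := by
  classical
  rw [Measure.real, PMF.toMeasure_apply_fintype, ENNReal.toReal_sum]
  · refine Finset.sum_congr rfl fun x _ => ?_
    simp only [Set.indicator_apply]
    split_ifs <;> simp
  · intro x _
    simp only [Set.indicator_apply]
    split_ifs
    · exact D.apply_ne_top x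
    · simp

lemma LogLipschitz.le_mul {n : ℕ} {α : ℝ} (hα : 0 < α) {D : PMF (Cube n)}
    (hD : LogLipschitz α D) {x x' : Cube n} (h : hammingDist x x' = 1) :
    (D x).toReal ≤ α * (D x').toReal := by
  have h1 := (abs_le.1 (hD.2 x x' h)).2
  rw [← Real.log_le_log_iff (hD.1 x) (mul_pos hα (hD.1 x')),
    Real.log_mul hα.ne' (hD.1 x').ne']
  linarith

theorem exists_pow_robustRisk_le {α : ℝ} (hα : 0 < α) (k : ℕ) :
    ∃ q : ℕ, ∀ (n : ℕ) (D : PMF (Cube n)), LogLipschitz α D →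
      ∀ (L L' : List (Term n × Bool)) (v v' : Bool), (∀ p ∈ L, p.1.card ≤ k) →
        (∀ p ∈ L', p.1.card ≤ k) → ∀ ρ : ℕ,
        (robustRisk D ρ (evalNodes L v) (evalNodes L' v') /
          (2 ^ ρ * ((L.length + 1) * (L'.length + 1)))) ^ q ≤
            D.toMeasure.real {x | evalNodes L v x ≠ evalNodes L' v' x} := by
  obtain ⟨q, -, H⟩ := exists_pow_mass_nbhd_disagreement_le hα.le k
  refine ⟨q, fun n D hD L L' v v' hL hL' ρ => ?_⟩
  have := H n (fun x => (D x).toReal) (fun x => ENNReal.toReal_nonneg)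
    (fun x x' h => hD.le_mul hα h) (sum_toReal_eq_one D).le L L' v v' hL hL' ρ
  rw [toMeasure_real_eq_mass, robustRisk, toMeasure_real_eq_mass]
  convert this using 4
  ext x
  simp only [nbhd, Set.mem_ofPred_eq, and_comm]

/-! ### Consistent hypotheses from a finite class -/

lemma sampleMeasure_real_consistent {n m : ℕ} (D : PMF (Cube n)) (G : Set (Cube n)) :
    (sampleMeasure D m).real {S | ∀ i, S i ∈ G} = D.toMeasure.real G ^ m := by
  have : {S : Fin m → Cube n | ∀ i, S i ∈ G} = Set.univ.pi fun _ => G := by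
    ext S
    simp
  rw [this, sampleMeasure, Measure.real, Measure.pi_pi, ENNReal.toReal_prod]
  simp [Measure.real]

/-- The union bound for consistent learners: a fixed hypothesis of risk at least `η` is consistent
with probability at most `(1 - η) ^ m`. Using `1 / δ` in place of `log (1 / δ)` keeps the sample
size polynomial. -/
theorem lt_sampleMeasure_real_of_consistent {n m : ℕ} (D : PMF (Cube n)) (c : Cube n → Bool)
    {ι : Type*} [Fintype ι] (h : ι → Cube n → Bool) {η δ : ℝ} (hδ : 0 < δ)
    (hm : Real.log (Fintype.card ι) + 1 / δ ≤ η * m) {T : Set (Fin m → Cube n)}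
    (hT : ∀ S : Fin m → Cube n, S ∉ T → ∃ i, (∀ j, h i (S j) = c (S j)) ∧
      η ≤ D.toMeasure.real {x | h i x ≠ c x}) :
    1 - δ < (sampleMeasure D m).real T := by
  classical
  have : IsProbabilityMeasure (sampleMeasure D m) := by
    unfold sampleMeasure
    infer_instance
  have hbad : (sampleMeasure D m).real Tᶜ < δ := by
    set B := Finset.univ.filter fun i => η ≤ D.toMeasure.real {x | h i x ≠ c x} with hB
    have hsub : Tᶜ ⊆ ⋃ i ∈ B, {S | ∀ j, S j ∈ {x | h i x = c x}} := by
      intro S hS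
      obtain ⟨i, hi, hη⟩ := hT S hS
      simp only [Set.mem_iUnion]
      exact ⟨i, by simpa [hB] using hη, hi⟩
    have hterm : ∀ i ∈ B, (sampleMeasure D m).real {S | ∀ j, S j ∈ {x | h i x = c x}} ≤
        Real.exp (-(η * m)) := by
      intro i hi
      have hη : η ≤ D.toMeasure.real {x | h i x ≠ c x} := by simpa [hB] using hi
      have hcompl : D.toMeasure.real {x | h i x = c x} =
          1 - D.toMeasure.real {x | h i x ≠ c x} := by
        rw [← probReal_compl_eq_one_sub (Set.toFinite _).measurableSet]
        congr 1
        ext x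
        simp
      rw [sampleMeasure_real_consistent, hcompl, mul_comm, ← mul_neg, Real.exp_nat_mul]
      refine pow_le_pow_left₀ (sub_nonneg.2 measureReal_le_one) ?_ m
      have := Real.add_one_le_exp (-η)
      linarith
    have hsum : (sampleMeasure D m).real Tᶜ ≤ Fintype.card ι * Real.exp (-(η * m)) := by
      refine (measureReal_mono hsub (measure_ne_top _ _)).trans ((measureReal_biUnion_finset_le _ _).trans ?_)
      refine (Finset.sum_le_card_nsmul _ _ _ hterm).trans ?_
      rw [nsmul_eq_mul]
      gcongr
      exact Finset.card_le_univ B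
    -- The empty class is separate because `exp (log 0)` is not `0`.
    rcases Nat.eq_zero_or_pos (Fintype.card ι) with h0 | h0
    · rw [h0, Nat.cast_zero, zero_mul] at hsum
      exact hsum.trans_lt hδ
    · have hpos : (0 : ℝ) < Fintype.card ι := by exact_mod_cast h0
      refine hsum.trans_lt ?_
      calc Fintype.card ι * Real.exp (-(η * m))
          ≤ Fintype.card ι * Real.exp (-(Real.log (Fintype.card ι) + 1 / δ)) := by gcongr
        _ = Real.exp (-(1 / δ)) := by
            rw [neg_add, Real.exp_add, Real.exp_neg, Real.exp_log hpos,
              mul_inv_cancel_left₀ hpos.ne']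
        _ < δ := by
            rw [Real.exp_neg, inv_lt_comm₀ (Real.exp_pos _) hδ, ← one_div]
            have := Real.add_one_le_exp (1 / δ)
            linarith
  have := probReal_compl_eq_one_sub (μ := sampleMeasure D m)
    (s := T) (Set.toFinite _).measurableSet
  linarith

/-! ### A greedy learner for decision lists

The learner works on decision lists over natural-number variables, with terms given as lists of
literals. -/

/-- `x ⊨ t`, for a term given as a list of literals and an assignment given as a list of bits. -/
def RawSat (t : List (ℕ × Bool)) (x : List Bool) : Prop := ∀ l ∈ t, x.getD l.1 false = l.2

instance : DecidableRel RawSat :=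
  fun t x => inferInstanceAs (Decidable (∀ l ∈ t, x.getD l.1 false = l.2))

/-- The value of the first node whose term is true on `x`, and `false` if there is none. -/
def rawEval : List (List (ℕ × Bool) × Bool) → List Bool → Bool
  | [], _ => false
  | p :: L, x => if RawSat p.1 x then p.2 else rawEval L x

/-- All literals over the first `n` variables. -/
def rawLits (n : ℕ) : List (ℕ × Bool) := (List.range n).flatMap fun i => [(i, false), (i, true)]

/-- All terms with at most `k` literals over the first `n` variables. -/
def rawTerms : ℕ → ℕ → List (List (ℕ × Bool))
  | 0, _ => [[]]
  | k + 1, n => [] :: (rawLits n).flatMap fun l => (rawTerms k n).map fun t => l :: t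

/-- All nodes with terms in `rawTerms k n`. -/
def rawNodes (k n : ℕ) : List (List (ℕ × Bool) × Bool) :=
  (rawTerms k n).flatMap fun t => [(t, false), (t, true)]

/-- The examples that satisfy no term of `L`. -/
def uncovered (S : List (List Bool × Bool)) (L : List (List (ℕ × Bool) × Bool)) :
    List (List Bool × Bool) :=
  S.filter fun e => ∀ p ∈ L, ¬ RawSat p.1 e.1

/-- Some example in `U` reaches the node `p`, and all that do have the label of `p`. -/
def Fits (p : List (ℕ × Bool) × Bool) (U : List (List Bool × Bool)) : Prop :=
  (∃ e ∈ U, RawSat p.1 e.1) ∧ ∀ e ∈ U, RawSat p.1 e.1 → e.2 = p.2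

instance : DecidableRel Fits := fun p U =>
  inferInstanceAs (Decidable ((∃ e ∈ U, RawSat p.1 e.1) ∧ ∀ e ∈ U, RawSat p.1 e.1 → e.2 = p.2))

/-- Append a node that fits the uncovered examples, if there is one. -/
def greedyStep (N : List (List (ℕ × Bool) × Bool)) (S : List (List Bool × Bool))
    (L : List (List (ℕ × Bool) × Bool)) : List (List (ℕ × Bool) × Bool) :=
  L ++ [(N.filter fun p => Fits p (uncovered S L)).head?.getD ([], false)]

/-- The nodes of the decision list that the greedy learner finds. -/
def greedy (k n : ℕ) (S : List (List Bool × Bool)) : List (List (ℕ × Bool) × Bool) :=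
  (greedyStep (rawNodes k n) S)^[(rawTerms k n).length] []

/-! ### Membership and counting for raw terms and nodes -/

section RawTerms

lemma mem_rawLits {n : ℕ} {l : ℕ × Bool} : l ∈ rawLits n ↔ l.1 < n := by
  obtain ⟨i, b⟩ := l
  cases b <;> simp [rawLits]

lemma length_rawLits (n : ℕ) : (rawLits n).length = 2 * n := by
  simp [rawLits, List.length_flatMap, mul_comm]

lemma nil_mem_rawTerms (k n : ℕ) : [] ∈ rawTerms k n := by
  cases k <;> simp [rawTerms]

lemma mem_rawTerms {k n : ℕ} {t : List (ℕ × Bool)} :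
    t ∈ rawTerms k n ↔ t.length ≤ k ∧ ∀ l ∈ t, l.1 < n := by
  induction k generalizing t with
  | zero =>
    simp only [rawTerms, List.mem_singleton, Nat.le_zero, List.length_eq_zero_iff]
    constructor
    · rintro rfl
      simp
    · exact And.left
  | succ k ih =>
    cases t with
    | nil => simp [rawTerms]
    | cons l t =>
      simp only [rawTerms, List.mem_cons, reduceCtorEq, false_or, List.mem_flatMap, List.mem_map,
        List.cons.injEq, mem_rawLits, ih, List.length_cons, Nat.add_le_add_iff_right,
        forall_eq_or_imp]
      constructor
      · rintro ⟨_, hl, _, ⟨h1, h2⟩, rfl, rfl⟩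
        exact ⟨h1, hl, h2⟩
      · rintro ⟨h1, hl, h2⟩
        exact ⟨l, hl, t, ⟨h1, h2⟩, rfl, rfl⟩

lemma length_rawTerms_le (k n : ℕ) : (rawTerms k n).length ≤ (2 * n + 1) ^ k := by
  induction k with
  | zero => simp [rawTerms]
  | succ k ih =>
    have h1 : (rawTerms (k + 1) n).length = 2 * n * (rawTerms k n).length + 1 := by
      simp [rawTerms, List.length_flatMap, length_rawLits]
    rw [h1, pow_succ']
    have h2 : 1 ≤ (2 * n + 1) ^ k := Nat.one_le_pow _ _ (by omega)
    nlinarith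

lemma mem_rawNodes {k n : ℕ} {p : List (ℕ × Bool) × Bool} :
    p ∈ rawNodes k n ↔ p.1 ∈ rawTerms k n := by
  obtain ⟨t, b⟩ := p
  cases b <;> simp [rawNodes]

lemma length_rawNodes (k n : ℕ) : (rawNodes k n).length = 2 * (rawTerms k n).length := by
  simp [rawNodes, List.length_flatMap, mul_comm]

end RawTerms

/-! ### Consistency of the greedy list -/

section Greedy

variable {k n : ℕ} {S : List (List Bool × Bool)}

lemma rawEval_append_of_sat {L : List (List (ℕ × Bool) × Bool)} {x : List Bool}
    (h : ∃ p ∈ L, RawSat p.1 x) (L' : List (List (ℕ × Bool) × Bool)) :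
    rawEval (L ++ L') x = rawEval L x := by
  induction L with
  | nil => simp at h
  | cons a L ih =>
    by_cases ha : RawSat a.1 x
    · simp [rawEval, ha]
    · have : ∃ p ∈ L, RawSat p.1 x := by
        obtain ⟨p, hp, hs⟩ := h
        rcases List.mem_cons.1 hp with rfl | hp
        · exact absurd hs ha
        · exact ⟨p, hp, hs⟩
      simp [rawEval, ha, ih this]

lemma rawEval_append_of_not_sat {L : List (List (ℕ × Bool) × Bool)} {x : List Bool}
    (h : ∀ p ∈ L, ¬ RawSat p.1 x) (L' : List (List (ℕ × Bool) × Bool)) :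
    rawEval (L ++ L') x = rawEval L' x := by
  induction L with
  | nil => rfl
  | cons a L ih =>
    have ha := h a List.mem_cons_self
    simp [rawEval, ha, ih fun p hp => h p (List.mem_cons_of_mem _ hp)]

lemma length_greedyStep (N : List (List (ℕ × Bool) × Bool)) (S : List (List Bool × Bool))
    (L : List (List (ℕ × Bool) × Bool)) : (greedyStep N S L).length = L.length + 1 := by
  simp [greedyStep]

lemma mem_greedyStep {L : List (List (ℕ × Bool) × Bool)} (hL : ∀ p ∈ L, p ∈ rawNodes k n) :
    ∀ p ∈ greedyStep (rawNodes k n) S L, p ∈ rawNodes k n := by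
  intro p hp
  rcases List.mem_append.1 hp with hp | hp
  · exact hL p hp
  · rw [List.mem_singleton.1 hp]
    cases h : (rawNodes k n).filter fun p => Fits p (uncovered S L) with
    | nil => simpa using mem_rawNodes.2 (nil_mem_rawTerms k n)
    | cons q Q => exact List.mem_of_mem_filter (h ▸ List.mem_cons_self : q ∈ _)

lemma length_greedy (k n : ℕ) (S : List (List Bool × Bool)) :
    (greedy k n S).length = (rawTerms k n).length := by
  have : ∀ i, ((greedyStep (rawNodes k n) S)^[i] []).length = i := by
    intro i
    induction i with
    | zero => rfl
    | succ i ih => rw [Function.iterate_succ_apply', length_greedyStep, ih]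
  exact this _

lemma mem_rawNodes_of_mem_greedy : ∀ p ∈ greedy k n S, p ∈ rawNodes k n := by
  have : ∀ i, ∀ p ∈ (greedyStep (rawNodes k n) S)^[i] [], p ∈ rawNodes k n := by
    intro i
    induction i with
    | zero => simp
    | succ i ih =>
      rw [Function.iterate_succ_apply']
      exact mem_greedyStep ih
  exact this _

lemma mem_uncovered {L : List (List (ℕ × Bool) × Bool)} {e : List Bool × Bool} :
    e ∈ uncovered S L ↔ e ∈ S ∧ ∀ p ∈ L, ¬ RawSat p.1 e.1 := by
  simp [uncovered]

/-- The second invariant measures progress: until all examples are covered, every step uses a new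
term. -/
lemma greedyStep_inv
    (hfit : ∀ U : List (List Bool × Bool), U ⊆ S → U ≠ [] → ∃ p ∈ rawNodes k n, Fits p U)
    {L : List (List (ℕ × Bool) × Bool)}
    (hcons : ∀ e ∈ S, (∃ p ∈ L, RawSat p.1 e.1) → rawEval L e.1 = e.2)
    (hnodup : uncovered S L = [] ∨ (L.map Prod.fst).Nodup) :
    (∀ e ∈ S, (∃ p ∈ greedyStep (rawNodes k n) S L, RawSat p.1 e.1) →
        rawEval (greedyStep (rawNodes k n) S L) e.1 = e.2) ∧
      (uncovered S (greedyStep (rawNodes k n) S L) = [] ∨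
        ((greedyStep (rawNodes k n) S L).map Prod.fst).Nodup) := by
  have hstep : greedyStep (rawNodes k n) S L =
    L ++ [((rawNodes k n).filter fun p => Fits p (uncovered S L)).head?.getD ([], false)] := rfl
  cases h : (rawNodes k n).filter fun p => Fits p (uncovered S L) with
  | nil =>
    have hU : uncovered S L = [] := by
      by_contra hne
      obtain ⟨p, hp, hpU⟩ := hfit _ (List.filter_subset_self _ : uncovered S L ⊆ S) hne
      have : p ∈ (rawNodes k n).filter fun p => Fits p (uncovered S L) :=
        List.mem_filter.2 ⟨hp, decide_eq_true hpU⟩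
      rw [h] at this
      simp at this
    have hcov : ∀ e ∈ S, ∃ p ∈ L, RawSat p.1 e.1 := by
      intro e he
      by_contra! hcon
      have := mem_uncovered.2 ⟨he, hcon⟩
      rw [hU] at this
      simp at this
    -- No node fits, so all examples are already covered and the appended default node is never
    -- reached by them.
    refine ⟨fun e he _ => ?_, Or.inl ?_⟩
    · rw [hstep, rawEval_append_of_sat (hcov e he)]
      exact hcons e he (hcov e he)
    · rw [List.eq_nil_iff_forall_not_mem]
      intro e he
      obtain ⟨heS, hne⟩ := mem_uncovered.1 he
      obtain ⟨p, hp, hs⟩ := hcov e heS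
      exact hne p (by rw [hstep]; exact List.mem_append_left _ hp) hs
  | cons p Q =>
    have hp : p ∈ (rawNodes k n).filter fun p => Fits p (uncovered S L) := by simp [h]
    have hfits : Fits p (uncovered S L) := by simpa using (List.mem_filter.1 hp).2
    rw [h, List.head?_cons, Option.getD_some] at hstep
    rw [hstep]
    refine ⟨fun e he hsat => ?_, Or.inr ?_⟩
    · by_cases hcov : ∃ p ∈ L, RawSat p.1 e.1
      · rw [rawEval_append_of_sat hcov]
        exact hcons e he hcov
      · push Not at hcov
        have hpe : RawSat p.1 e.1 := by
          obtain ⟨r, hr, hs⟩ := hsat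
          rcases List.mem_append.1 hr with hr | hr
          · exact absurd hs (hcov r hr)
          · exact List.mem_singleton.1 hr ▸ hs
        rw [rawEval_append_of_not_sat hcov, rawEval, if_pos hpe]
        exact (hfits.2 e (mem_uncovered.2 ⟨he, hcov⟩) hpe).symm
    -- The new term holds at an example on which all earlier terms fail, so it differs from each of
    -- them.
    · obtain ⟨e, heU, hpe⟩ := hfits.1
      obtain ⟨-, hne⟩ := mem_uncovered.1 heU
      rcases hnodup with h0 | hnd
      · rw [h0] at heU
        simp at heU
      · rw [List.map_append, List.nodup_append]
        refine ⟨hnd, by simp, ?_⟩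
        intro t ht t' ht' hEq
        obtain ⟨r, hr, rfl⟩ := List.mem_map.1 ht
        have : t' = p.1 := by simpa using ht'
        exact hne r hr (by rw [hEq, this]; exact hpe)

theorem rawEval_greedy
    (hfit : ∀ U : List (List Bool × Bool), U ⊆ S → U ≠ [] → ∃ p ∈ rawNodes k n, Fits p U) :
    ∀ e ∈ S, rawEval (greedy k n S) e.1 = e.2 := by
  have hinv : ∀ i, (∀ e ∈ S, (∃ p ∈ (greedyStep (rawNodes k n) S)^[i] [], RawSat p.1 e.1) →
        rawEval ((greedyStep (rawNodes k n) S)^[i] []) e.1 = e.2) ∧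
      (uncovered S ((greedyStep (rawNodes k n) S)^[i] []) = [] ∨
        (((greedyStep (rawNodes k n) S)^[i] []).map Prod.fst).Nodup) := by
    intro i
    induction i with
    | zero => simp
    | succ i ih =>
      rw [Function.iterate_succ_apply']
      exact greedyStep_inv hfit ih.1 ih.2
  obtain ⟨h1, h2⟩ := hinv (rawTerms k n).length
  intro e he
  refine h1 e he ?_
  change ∃ p ∈ greedy k n S, RawSat p.1 e.1
  change uncovered S (greedy k n S) = [] ∨ ((greedy k n S).map Prod.fst).Nodup at h2
  rcases h2 with h2 | h2
  · by_contra! hcon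
    have := mem_uncovered.2 ⟨he, hcon⟩
    rw [h2] at this
    simp at this
  · have hsub : (greedy k n S).map Prod.fst ⊆ rawTerms k n := by
      intro t ht
      obtain ⟨p, hp, rfl⟩ := List.mem_map.1 ht
      exact mem_rawNodes.1 (mem_rawNodes_of_mem_greedy p hp)
    -- Distinct terms, as many as there are available, exhaust `rawTerms k n`; in particular the
    -- empty term occurs, and it covers everything.
    have hperm := (h2.subperm hsub).perm_of_length_le (by rw [List.length_map, length_greedy])
    obtain ⟨p, hp, hnil⟩ := List.mem_map.1 (hperm.mem_iff.2 (nil_mem_rawTerms k n))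
    exact ⟨p, hp, by simp [hnil, RawSat]⟩

end Greedy

/-! ### Passing between terms and lists of literals -/

/-- A term as a list of literals. -/
noncomputable def Term.toRaw {n : ℕ} (K : Term n) : List (ℕ × Bool) :=
  K.toList.map fun l => ((l.1 : ℕ), l.2)

/-- A list of literals over the first `n` variables as a term. -/
def rawToTerm (n : ℕ) (t : List (ℕ × Bool)) : Term n :=
  Finset.univ.filter fun l => ((l.1 : ℕ), l.2) ∈ t

section Raw

variable {n : ℕ}

lemma getD_ofFn (x : Cube n) (i : Fin n) : (List.ofFn x).getD i false = x i := by
  simp [List.getD_eq_getElem?_getD]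

lemma Term.rawSat_toRaw {K : Term n} {x : Cube n} :
    RawSat K.toRaw (List.ofFn x) ↔ K.Sat x := by
  simp only [RawSat, Term.toRaw, List.forall_mem_map, getD_ofFn, Finset.mem_toList, Term.Sat]

lemma Term.toRaw_mem_rawTerms {k : ℕ} {K : Term n} (hK : K.card ≤ k) :
    K.toRaw ∈ rawTerms k n := by
  refine mem_rawTerms.2 ⟨by simpa [Term.toRaw] using hK, fun l hl => ?_⟩
  obtain ⟨l', -, rfl⟩ := List.mem_map.1 hl
  exact l'.1.isLt

lemma card_rawToTerm_le (t : List (ℕ × Bool)) : (rawToTerm n t).card ≤ t.length := by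
  refine le_trans ?_ (List.toFinset_card_le t)
  refine Finset.card_le_card_of_injOn (fun l => ((l.1 : ℕ), l.2)) (fun l hl => ?_) ?_
  · simpa [rawToTerm] using hl
  · rintro ⟨i, b⟩ - ⟨j, d⟩ - h
    simpa [Fin.ext_iff] using h

lemma sat_rawToTerm {t : List (ℕ × Bool)} (ht : ∀ l ∈ t, l.1 < n) {x : Cube n} :
    (rawToTerm n t).Sat x ↔ RawSat t (List.ofFn x) := by
  constructor
  · intro h l hl
    have := h (⟨l.1, ht l hl⟩, l.2) (by simpa [rawToTerm] using hl)
    rw [← this]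
    exact getD_ofFn x ⟨l.1, ht l hl⟩
  · intro h l hl
    rw [← getD_ofFn x]
    exact h _ (by simpa [rawToTerm] using hl)

lemma rawEval_eq_evalNodes {L : List (List (ℕ × Bool) × Bool)}
    (hL : ∀ p ∈ L, ∀ l ∈ p.1, l.1 < n) (x : Cube n) :
    rawEval L (List.ofFn x) =
      evalNodes (L.map fun p => (rawToTerm n p.1, p.2)) false x := by
  induction L with
  | nil => rfl
  | cons a L ih =>
    simp only [List.map_cons, rawEval, evalNodes,
      sat_rawToTerm (hL a List.mem_cons_self), ih fun p hp => hL p (List.mem_cons_of_mem _ hp)]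

/-- The first node of the target list reached by some example of `U` fits: no example of `U` stops
earlier. If none is reached, the empty term with the final value fits. -/
lemma exists_fits {k : ℕ} {L : List (Term n × Bool)} (hL : ∀ p ∈ L, p.1.card ≤ k) {v : Bool}
    {U : List (List Bool × Bool)} (hU : U ≠ [])
    (hlab : ∀ e ∈ U, ∃ x : Cube n, e = (List.ofFn x, evalNodes L v x)) :
    ∃ p ∈ rawNodes k n, Fits p U := by
  induction L with
  | nil =>
    refine ⟨([], v), mem_rawNodes.2 (nil_mem_rawTerms k n), ?_, fun e he _ => ?_⟩
    · obtain ⟨e, he⟩ := List.exists_mem_of_ne_nil U hU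
      exact ⟨e, he, by simp [RawSat]⟩
    · obtain ⟨x, rfl⟩ := hlab e he
      rfl
  | cons a L ih =>
    by_cases h : ∃ e ∈ U, RawSat a.1.toRaw e.1
    · refine ⟨(a.1.toRaw, a.2),
        mem_rawNodes.2 (Term.toRaw_mem_rawTerms (hL a List.mem_cons_self)), h, fun e he hs => ?_⟩
      obtain ⟨x, rfl⟩ := hlab e he
      exact if_pos (Term.rawSat_toRaw.1 hs)
    · push Not at h
      refine ih (fun p hp => hL p (List.mem_cons_of_mem _ hp)) fun e he => ?_
      obtain ⟨x, rfl⟩ := hlab e he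
      refine ⟨x, ?_⟩
      have : ¬ a.1.Sat x := fun hs => h _ he (Term.rawSat_toRaw.2 hs)
      rw [evalNodes, if_neg this]

lemma rawEval_greedy_labelled {k m : ℕ} {L : List (Term n × Bool)}
    (hL : ∀ p ∈ L, p.1.card ≤ k) (v : Bool) (S : Fin m → Cube n) (j : Fin m) :
    rawEval (greedy k n (labelled (evalNodes L v) S)) (List.ofFn (S j)) =
      evalNodes L v (S j) := by
  refine rawEval_greedy (fun U hU hne => exists_fits hL hne (v := v) fun e he => ?_)
    (List.ofFn (S j), evalNodes L v (S j)) ?_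
  · obtain ⟨i, rfl⟩ := List.mem_ofFn.1 (hU he)
    exact ⟨S i, rfl⟩
  · exact List.mem_ofFn.2 ⟨j, rfl⟩

end Raw

/-! ### Decision lists as circuits -/

/-- Conjoin a literal to the last wire of `C`. -/
def compileLit (n : ℕ) (C : Circuit) (l : ℕ × Bool) : Circuit :=
  C ++ if l.2 then [(n + C.length - 1, l.1), (n + C.length, n + C.length)]
    else [(l.1, l.1), (n + C.length - 1, n + C.length), (n + C.length + 1, n + C.length + 1)]

/-- Conjoin the literals of `t` on a new wire that starts as the constant `true`. -/
def compileTerm (n : ℕ) (t : List (ℕ × Bool)) (C : Circuit) : Circuit :=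
  t.foldl (compileLit n) (C ++ [(n + C.length, n + C.length)])

/-- The gates that select between the value `u` and wire `a`, where wire `d - 1` is the condition
and wire `d` is the next one. -/
def selectGates (u : Bool) (a d : ℕ) : Circuit :=
  if u then [(d - 1, d - 1), (a, a), (d, d + 1)] else [(d - 1, d - 1), (d, a), (d + 1, d + 1)]

/-- Put the node `p` in front of the decision list computed by `C`. -/
def compileNode (n : ℕ) (p : List (ℕ × Bool) × Bool) (C : Circuit) : Circuit :=
  compileTerm n p.1 C ++ selectGates p.2 (n + C.length - 1) (n + (compileTerm n p.1 C).length)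

/-- The circuit that computes `rawEval L` on `n` inputs. -/
def compile (n : ℕ) (L : List (List (ℕ × Bool) × Bool)) : Circuit :=
  L.foldr (compileNode n) [(n, n), (n, n)]

/-! ### Semantics of the compiled circuits -/

section Wires

variable {w : List Bool} {n : ℕ}

lemma wires_append (C D : Circuit) (w : List Bool) :
    Circuit.wires (C ++ D) w = Circuit.wires D (Circuit.wires C w) := by
  induction C generalizing w with
  | nil => rfl
  | cons g C ih => exact ih _

lemma length_wires (C : Circuit) (w : List Bool) :
    (Circuit.wires C w).length = w.length + C.length := by
  induction C generalizing w with
  | nil => rfl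
  | cons g C ih =>
    rw [Circuit.wires, ih, List.length_append, List.length_singleton, List.length_cons]
    omega

lemma exists_wires_eq_append (C : Circuit) (w : List Bool) : ∃ E, Circuit.wires C w = w ++ E := by
  induction C generalizing w with
  | nil => exact ⟨[], by simp [Circuit.wires]⟩
  | cons g C ih =>
    obtain ⟨E, hE⟩ := ih (w ++ [!(w.getD g.1 false && w.getD g.2 false)])
    exact ⟨_, hE.trans (List.append_assoc _ _ _)⟩

/-- The value of wire `i`. -/
def wire (w : List Bool) (C : Circuit) (i : ℕ) : Bool := (Circuit.wires C w).getD i false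

lemma wire_append_of_lt {C : Circuit} (D : Circuit) {i : ℕ} (hi : i < w.length + C.length) :
    wire w (C ++ D) i = wire w C i := by
  obtain ⟨E, hE⟩ := exists_wires_eq_append D (Circuit.wires C w)
  rw [wire, wires_append, hE, wire, List.getD_append]
  rwa [length_wires]

lemma wire_input (C : Circuit) {i : ℕ} (hi : i < w.length) : wire w C i = w.getD i false :=
  wire_append_of_lt (C := []) C (by simpa using hi)

lemma wire_of_le {C : Circuit} {i : ℕ} (hi : w.length + C.length ≤ i) : wire w C i = false :=
  List.getD_eq_default _ _ (by rwa [length_wires])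

lemma wire_concat (C : Circuit) (g : ℕ × ℕ) :
    wire w (C ++ [g]) (w.length + C.length) = !(wire w C g.1 && wire w C g.2) := by
  rw [wire, wires_append, ← length_wires]
  simp only [Circuit.wires]
  rw [List.getD_append_right _ _ _ _ le_rfl]
  simp [wire]

/-- The value of the last wire. -/
def lastWire (w : List Bool) (C : Circuit) : Bool := wire w C (w.length + C.length - 1)

lemma lastWire_concat (C : Circuit) (g : ℕ × ℕ) :
    lastWire w (C ++ [g]) = !(wire w C g.1 && wire w C g.2) := by
  rw [← wire_concat, lastWire, List.length_append, List.length_singleton]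
  rfl

lemma eval_eq_lastWire (C : Circuit) {n : ℕ} (x : Cube n) :
    C.eval x = lastWire (List.ofFn x) C := by
  rw [Circuit.eval, lastWire, wire, ← length_wires, List.getLastD_eq_getLast?,
    List.getLast?_eq_getElem?, List.getD_eq_getElem?_getD]

lemma lastWire_append_two (C : Circuit) (g₁ g₂ : ℕ × ℕ) :
    lastWire w (C ++ [g₁, g₂]) = !(wire w (C ++ [g₁]) g₂.1 && wire w (C ++ [g₁]) g₂.2) := by
  rw [← lastWire_concat, List.append_assoc, List.singleton_append]

lemma lastWire_append_three (C : Circuit) (g₁ g₂ g₃ : ℕ × ℕ) :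
    lastWire w (C ++ [g₁, g₂, g₃]) =
      !(wire w (C ++ [g₁, g₂]) g₃.1 && wire w (C ++ [g₁, g₂]) g₃.2) := by
  rw [← lastWire_concat, List.append_assoc]
  rfl

lemma wire_append_two_first (C : Circuit) (g₁ g₂ : ℕ × ℕ) :
    wire w (C ++ [g₁, g₂]) (w.length + C.length) = !(wire w C g₁.1 && wire w C g₁.2) := by
  have : C ++ [g₁, g₂] = C ++ [g₁] ++ [g₂] := by simp
  rw [this, wire_append_of_lt [g₂] (by simp), wire_concat]

lemma wire_append_two_second (C : Circuit) (g₁ g₂ : ℕ × ℕ) :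
    wire w (C ++ [g₁, g₂]) (w.length + C.length + 1) =
      !(wire w (C ++ [g₁]) g₂.1 && wire w (C ++ [g₁]) g₂.2) := by
  have : C ++ [g₁, g₂] = C ++ [g₁] ++ [g₂] := by simp
  rw [this, ← wire_concat (C ++ [g₁]), List.length_append, List.length_singleton, add_assoc]

lemma lastWire_compileLit {C : Circuit} (hC : C ≠ []) (l : ℕ × Bool) (hl : l.1 < w.length) :
    lastWire w (compileLit w.length C l) = (lastWire w C && w.getD l.1 false == l.2) := by
  obtain ⟨i, b⟩ := l
  have hpos : 0 < C.length := List.length_pos_iff.2 hC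
  have hlast : w.length + C.length - 1 < w.length + C.length := by omega
  cases b
  · rw [compileLit, if_neg Bool.false_ne_true, lastWire_append_three, wire_append_two_second,
      wire_append_of_lt _ hlast, wire_concat, wire_input _ hl, lastWire]
    cases wire w C (w.length + C.length - 1) <;> cases w.getD i false <;> rfl
  · rw [compileLit, if_pos rfl, lastWire_append_two, wire_concat, wire_input _ hl, lastWire]
    cases wire w C (w.length + C.length - 1) <;> cases w.getD i false <;> rfl

lemma compileLit_ne_nil {C : Circuit} (hC : C ≠ []) (l : ℕ × Bool) : compileLit n C l ≠ [] := by
  simp [compileLit, hC]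

lemma lastWire_foldl_compileLit (t : List (ℕ × Bool)) (ht : ∀ l ∈ t, l.1 < w.length)
    {C : Circuit} (hC : C ≠ []) :
    lastWire w (t.foldl (compileLit w.length) C) = (lastWire w C && decide (RawSat t w)) := by
  induction t generalizing C with
  | nil => simp [RawSat]
  | cons l t ih =>
    rw [List.foldl_cons, ih (fun l hl => ht l (List.mem_cons_of_mem _ hl))
      (compileLit_ne_nil hC l), lastWire_compileLit hC l (ht l List.mem_cons_self)]
    have : RawSat (l :: t) w ↔ w.getD l.1 false = l.2 ∧ RawSat t w := by simp [RawSat]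
    rw [Bool.and_assoc, beq_eq_decide, ← Bool.decide_and]
    simp only [this]

lemma exists_foldl_compileLit (t : List (ℕ × Bool)) (C : Circuit) :
    ∃ D, t.foldl (compileLit n) C = C ++ D := by
  induction t generalizing C with
  | nil => exact ⟨[], by simp⟩
  | cons l t ih =>
    obtain ⟨D, hD⟩ := ih (compileLit n C l)
    exact ⟨_, hD.trans (List.append_assoc _ _ _)⟩

lemma exists_compileTerm (t : List (ℕ × Bool)) (C : Circuit) :
    ∃ g D, compileTerm n t C = C ++ g :: D := by
  obtain ⟨D, hD⟩ := exists_foldl_compileLit (n := n) t (C ++ [(n + C.length, n + C.length)])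
  exact ⟨_, D, hD.trans (List.append_assoc _ _ _)⟩

lemma lastWire_compileTerm (t : List (ℕ × Bool)) (ht : ∀ l ∈ t, l.1 < w.length) (C : Circuit) :
    lastWire w (compileTerm w.length t C) = decide (RawSat t w) := by
  -- The initial gate reads its own, not yet existing wire, which counts as `false`; its NAND is the
  -- constant `true`.
  rw [compileTerm, lastWire_foldl_compileLit t ht (by simp), lastWire_concat,
    wire_of_le le_rfl]
  simp

/-- With condition `c`, selecting `true` is `c ∨ a`, the NAND of the negations; selecting `false` is
`¬c ∧ a`, a negated NAND. -/
lemma lastWire_append_selectGates {C : Circuit} (hC : C ≠ []) (u : Bool) {a : ℕ}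
    (ha : a < w.length + C.length) :
    lastWire w (C ++ selectGates u a (w.length + C.length)) =
      if lastWire w C then u else wire w C a := by
  have hpos : 0 < C.length := List.length_pos_iff.2 hC
  have hlast : w.length + C.length - 1 < w.length + C.length := by omega
  cases u
  · rw [selectGates, if_neg Bool.false_ne_true, lastWire_append_three, wire_append_two_second,
      wire_concat, wire_append_of_lt _ ha, lastWire]
    cases wire w C (w.length + C.length - 1) <;> cases wire w C a <;> rfl
  · rw [selectGates, if_pos rfl, lastWire_append_three, wire_append_two_second,
      wire_append_two_first, wire_append_of_lt _ ha, lastWire]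
    cases wire w C (w.length + C.length - 1) <;> cases wire w C a <;> rfl

lemma lastWire_compileNode (p : List (ℕ × Bool) × Bool) (hp : ∀ l ∈ p.1, l.1 < w.length)
    {C : Circuit} (hC : C ≠ []) :
    lastWire w (compileNode w.length p C) = if RawSat p.1 w then p.2 else lastWire w C := by
  have hpos : 0 < C.length := List.length_pos_iff.2 hC
  obtain ⟨g, D, hD⟩ := exists_compileTerm (n := w.length) p.1 C
  have ha : w.length + C.length - 1 < w.length + (compileTerm w.length p.1 C).length := by
    rw [hD, List.length_append]
    omega
  rw [compileNode, lastWire_append_selectGates (by simp [hD]) p.2 ha,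
    lastWire_compileTerm p.1 hp, hD, wire_append_of_lt _ (by omega), lastWire]
  simp

lemma compile_ne_nil (L : List (List (ℕ × Bool) × Bool)) : compile n L ≠ [] := by
  cases L with
  | nil => simp [compile]
  | cons p L =>
    obtain ⟨g, D, hD⟩ := exists_compileTerm (n := n) p.1 (compile n L)
    rw [compile, List.foldr_cons, ← compile, compileNode, hD]
    simp

lemma lastWire_compile (L : List (List (ℕ × Bool) × Bool))
    (hL : ∀ p ∈ L, ∀ l ∈ p.1, l.1 < w.length) :
    lastWire w (compile w.length L) = rawEval L w := by
  induction L with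
  | nil =>
    -- The first gate reads a missing wire and gives `true`; the second reads the first and gives
    -- the default `false`.
    have : compile w.length [] = [] ++ [(w.length, w.length), (w.length, w.length)] := rfl
    rw [this, lastWire_append_two]
    have := wire_concat (w := w) [] (w.length, w.length)
    rw [List.length_nil, Nat.add_zero] at this
    rw [this, wire_of_le (by simp)]
    rfl
  | cons p L ih =>
    have : compile w.length (p :: L) = compileNode w.length p (compile w.length L) := rfl
    rw [this, lastWire_compileNode p (hL p List.mem_cons_self) (compile_ne_nil L),
      ih fun q hq => hL q (List.mem_cons_of_mem _ hq)]
    rfl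

lemma eval_compile (L : List (List (ℕ × Bool) × Bool)) (hL : ∀ p ∈ L, ∀ l ∈ p.1, l.1 < n)
    (x : Cube n) : (compile n L).eval x = rawEval L (List.ofFn x) := by
  rw [eval_eq_lastWire]
  have := lastWire_compile (w := List.ofFn x) L (by simpa using hL)
  rwa [List.length_ofFn] at this

end Wires

/-! ### The size of compiled circuits -/

section CircuitSize

variable {n : ℕ}

/-- All gates of `C` read from wires `0, …, N`. -/
def WiresLE (N : ℕ) (C : Circuit) : Prop := ∀ g ∈ C, g.1 ≤ N ∧ g.2 ≤ N

lemma WiresLE.append {N N' : ℕ} {C D : Circuit} (hC : WiresLE N C) (hD : WiresLE N' D)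
    (h : N ≤ N') : WiresLE N' (C ++ D) := by
  intro g hg
  rcases List.mem_append.1 hg with hg | hg
  · exact ⟨(hC g hg).1.trans h, (hC g hg).2.trans h⟩
  · exact hD g hg

lemma Circuit.size_le {N : ℕ} {C : Circuit} (hC : WiresLE N C) :
    C.size ≤ C.length * (1 + N + N) := by
  have hsize : ∀ m : ℕ, m.size ≤ m := fun m => Nat.size_le.2 Nat.lt_two_pow_self
  have := List.sum_le_card_nsmul (C.map fun g => 1 + g.1.size + g.2.size) (1 + N + N) <| by
    intro s hs
    obtain ⟨g, hg, rfl⟩ := List.mem_map.1 hs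
    have h1 := (hsize g.1).trans (hC g hg).1
    have h2 := (hsize g.2).trans (hC g hg).2
    omega
  simpa [Circuit.size] using this

lemma length_compileLit_le (C : Circuit) (l : ℕ × Bool) :
    C.length ≤ (compileLit n C l).length ∧ (compileLit n C l).length ≤ C.length + 3 := by
  rw [compileLit, List.length_append]
  split_ifs <;> simp

lemma WiresLE.compileLit {C : Circuit} (hC : WiresLE (n + C.length) C) {l : ℕ × Bool}
    (hl : l.1 < n) : WiresLE (n + (compileLit n C l).length) (compileLit n C l) := by
  refine hC.append ?_ (Nat.add_le_add_left (length_compileLit_le C l).1 n)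
  intro g hg
  rw [RobustDL.compileLit, List.length_append]
  split_ifs at hg ⊢ <;> simp only [List.mem_cons, List.not_mem_nil, or_false] at hg <;>
    simp only [List.length_cons, List.length_nil]
  · rcases hg with rfl | rfl <;> dsimp only <;> omega
  · rcases hg with rfl | rfl | rfl <;> dsimp only <;> omega

lemma foldl_compileLit_bounds (t : List (ℕ × Bool)) (ht : ∀ l ∈ t, l.1 < n) {C : Circuit}
    (hC : WiresLE (n + C.length) C) :
    WiresLE (n + (t.foldl (compileLit n) C).length) (t.foldl (compileLit n) C) ∧
      (t.foldl (compileLit n) C).length ≤ C.length + 3 * t.length := by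
  induction t generalizing C with
  | nil => exact ⟨hC, le_rfl⟩
  | cons l t ih =>
    obtain ⟨h1, h2⟩ := ih (fun l hl => ht l (List.mem_cons_of_mem _ hl))
      (hC.compileLit (ht l List.mem_cons_self))
    have h3 := (length_compileLit_le (n := n) C l).2
    refine ⟨h1, ?_⟩
    rw [List.foldl_cons, List.length_cons]
    omega

/-- One gate makes the constant `true`, each literal takes at most three, and the selection takes
three. -/
lemma compileNode_bounds (p : List (ℕ × Bool) × Bool) (hp : ∀ l ∈ p.1, l.1 < n) {C : Circuit}
    (hC : WiresLE (n + C.length) C) :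
    WiresLE (n + (compileNode n p C).length) (compileNode n p C) ∧
      (compileNode n p C).length ≤ C.length + (3 * p.1.length + 4) := by
  have h0 : WiresLE (n + (C ++ [(n + C.length, n + C.length)]).length)
      (C ++ [(n + C.length, n + C.length)]) := by
    refine hC.append ?_ (by simp)
    intro g hg
    rw [List.mem_singleton.1 hg, List.length_append]
    dsimp only
    omega
  obtain ⟨h1, h2⟩ := foldl_compileLit_bounds p.1 hp h0
  rw [← compileTerm] at h1 h2
  obtain ⟨g, D, hD⟩ := exists_compileTerm (n := n) p.1 C
  have h3 : C.length ≤ (compileTerm n p.1 C).length := by rw [hD, List.length_append]; omega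
  have h4 : (selectGates p.2 (n + C.length - 1) (n + (compileTerm n p.1 C).length)).length = 3 := by
    rw [selectGates]
    split_ifs <;> rfl
  have h5 : (compileNode n p C).length = (compileTerm n p.1 C).length + 3 := by
    rw [compileNode, List.length_append, h4]
  refine ⟨?_, ?_⟩
  · rw [h5]
    refine h1.append ?_ (by omega)
    intro g hg
    rw [selectGates] at hg
    split_ifs at hg <;> simp only [List.mem_cons, List.not_mem_nil, or_false] at hg <;>
      rcases hg with rfl | rfl | rfl <;> dsimp only <;> omega
  · rw [List.length_append, List.length_singleton] at h2
    omega

lemma compile_bounds {k : ℕ} (L : List (List (ℕ × Bool) × Bool))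
    (hL : ∀ p ∈ L, p.1 ∈ rawTerms k n) :
    WiresLE (n + (compile n L).length) (compile n L) ∧
      (compile n L).length ≤ 2 + L.length * (3 * k + 4) := by
  induction L with
  | nil => exact ⟨by simp [compile, WiresLE], by simp [compile]⟩
  | cons p L ih =>
    obtain ⟨h1, h2⟩ := ih fun q hq => hL q (List.mem_cons_of_mem _ hq)
    obtain ⟨h3, h4⟩ := mem_rawTerms.1 (hL p List.mem_cons_self)
    obtain ⟨h5, h6⟩ := compileNode_bounds p h4 h1
    refine ⟨h5, h6.trans ?_⟩
    rw [List.length_cons, Nat.add_mul, Nat.one_mul]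
    omega

end CircuitSize

/-! ### The learner is computable -/

section Computability

lemma primrecRel_rawSat : PrimrecRel RawSat := by
  have h : PrimrecRel fun (l : ℕ × Bool) (x : List Bool) => x.getD l.1 false = l.2 :=
    Primrec.eq.comp
      ((Primrec.list_getD false).comp Primrec.snd (Primrec.fst.comp Primrec.fst))
      (Primrec.snd.comp Primrec.fst)
  exact h.forall_mem_list

lemma primrec_uncovered : Primrec₂ uncovered := by
  have h : PrimrecRel fun (L : List (List (ℕ × Bool) × Bool)) (e : List Bool × Bool) =>
      ∀ p ∈ L, ¬ RawSat p.1 e.1 :=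
    PrimrecRel.forall_mem_list
      (PrimrecRel.comp primrecRel_rawSat (Primrec.fst.comp Primrec.fst)
        (Primrec.fst.comp Primrec.snd)).not
  exact h.swap.listFilter

lemma primrecRel_fits : PrimrecRel Fits := by
  have hsat : PrimrecRel fun (e : List Bool × Bool) (p : List (ℕ × Bool) × Bool) =>
      RawSat p.1 e.1 :=
    PrimrecRel.comp primrecRel_rawSat (Primrec.fst.comp Primrec.snd)
      (Primrec.fst.comp Primrec.fst)
  have hlab : PrimrecRel fun (e : List Bool × Bool) (p : List (ℕ × Bool) × Bool) =>
      ¬ RawSat p.1 e.1 ∨ e.2 = p.2 :=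
    hsat.not.or (Primrec.eq.comp (Primrec.snd.comp Primrec.fst) (Primrec.snd.comp Primrec.snd))
  have h : PrimrecRel fun (U : List (List Bool × Bool)) (p : List (ℕ × Bool) × Bool) =>
      (∃ e ∈ U, RawSat p.1 e.1) ∧ ∀ e ∈ U, ¬ RawSat p.1 e.1 ∨ e.2 = p.2 :=
    PrimrecPred.and hsat.exists_mem_list hlab.forall_mem_list
  refine h.swap.of_eq fun p U => ?_
  rw [Function.swap]
  simp only [Fits, imp_iff_not_or]

lemma primrec_greedyStep : Primrec fun a : (List (List (ℕ × Bool) × Bool) ×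
    List (List Bool × Bool)) × List (List (ℕ × Bool) × Bool) => greedyStep a.1.1 a.1.2 a.2 := by
  refine Primrec.list_append.comp Primrec.snd (Primrec.list_cons.comp ?_ (Primrec.const []))
  refine Primrec.option_getD.comp (Primrec.list_head?.comp ?_) (Primrec.const _)
  exact primrecRel_fits.listFilter.comp (Primrec.fst.comp Primrec.fst)
    (primrec_uncovered.comp (Primrec.snd.comp Primrec.fst) Primrec.snd)

lemma primrec_rawLits : Primrec rawLits := by
  refine Primrec.list_flatMap Primrec.list_range ?_
  exact Primrec.list_cons.comp (Primrec.pair Primrec.snd (Primrec.const false))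
    (Primrec.list_cons.comp (Primrec.pair Primrec.snd (Primrec.const true)) (Primrec.const []))

/-- As `k` is a constant of the learner, the recursion on it can be carried out by induction outside
the computation. -/
lemma primrec_rawTerms (k : ℕ) : Primrec (rawTerms k) := by
  induction k with
  | zero => exact Primrec.const [[]]
  | succ k ih =>
    refine Primrec.list_cons.comp (Primrec.const []) (Primrec.list_flatMap primrec_rawLits ?_)
    exact Primrec.list_map (ih.comp Primrec.fst)
      (Primrec.list_cons.comp (Primrec.snd.comp Primrec.fst) Primrec.snd)

lemma primrec_rawNodes (k : ℕ) : Primrec (rawNodes k) := by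
  refine Primrec.list_flatMap (primrec_rawTerms k) ?_
  exact Primrec.list_cons.comp (Primrec.pair Primrec.snd (Primrec.const false))
    (Primrec.list_cons.comp (Primrec.pair Primrec.snd (Primrec.const true)) (Primrec.const []))

lemma primrec_greedy (k : ℕ) : Primrec₂ (greedy k) := by
  refine Primrec.nat_iterate (Primrec.list_length.comp ((primrec_rawTerms k).comp Primrec.fst))
    (Primrec.const []) ?_
  exact primrec_greedyStep.comp (Primrec.pair (Primrec.pair
    ((primrec_rawNodes k).comp (Primrec.fst.comp Primrec.fst))
    (Primrec.snd.comp Primrec.fst)) Primrec.snd)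

lemma primrec_compileLit :
    Primrec fun a : ℕ × Circuit × (ℕ × Bool) => compileLit a.1 a.2.1 a.2.2 := by
  have hC : Primrec fun a : ℕ × Circuit × (ℕ × Bool) => a.2.1 := Primrec.fst.comp Primrec.snd
  have hi : Primrec fun a : ℕ × Circuit × (ℕ × Bool) => a.2.2.1 :=
    Primrec.fst.comp (Primrec.snd.comp Primrec.snd)
  have hb : Primrec fun a : ℕ × Circuit × (ℕ × Bool) => a.2.2.2 :=
    Primrec.snd.comp (Primrec.snd.comp Primrec.snd)
  have hd : Primrec fun a : ℕ × Circuit × (ℕ × Bool) => a.1 + a.2.1.length :=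
    Primrec.nat_add.comp Primrec.fst (Primrec.list_length.comp hC)
  have hd' := Primrec.nat_sub.comp hd (Primrec.const 1)
  have hd1 := Primrec.nat_add.comp hd (Primrec.const 1)
  refine Primrec.list_append.comp hC (Primrec.ite (Primrec.eq.comp hb (Primrec.const true)) ?_ ?_)
  · exact Primrec.list_cons.comp (hd'.pair hi) (Primrec.list_cons.comp (hd.pair hd)
      (Primrec.const []))
  · exact Primrec.list_cons.comp (hi.pair hi) (Primrec.list_cons.comp (hd'.pair hd)
      (Primrec.list_cons.comp (hd1.pair hd1) (Primrec.const [])))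

lemma primrec_compileTerm :
    Primrec fun a : ℕ × List (ℕ × Bool) × Circuit => compileTerm a.1 a.2.1 a.2.2 := by
  have hC : Primrec fun a : ℕ × List (ℕ × Bool) × Circuit => a.2.2 :=
    Primrec.snd.comp Primrec.snd
  have hd : Primrec fun a : ℕ × List (ℕ × Bool) × Circuit => a.1 + a.2.2.length :=
    Primrec.nat_add.comp Primrec.fst (Primrec.list_length.comp hC)
  refine Primrec.list_foldl (h := fun a s => compileLit a.1 s.1 s.2) (Primrec.fst.comp Primrec.snd)
    (Primrec.list_append.comp hC (Primrec.list_cons.comp (hd.pair hd) (Primrec.const []))) ?_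
  exact primrec_compileLit.comp (Primrec.pair (Primrec.fst.comp Primrec.fst)
    (Primrec.pair (Primrec.fst.comp Primrec.snd) (Primrec.snd.comp Primrec.snd)))

lemma primrec_selectGates :
    Primrec fun a : Bool × ℕ × ℕ => selectGates a.1 a.2.1 a.2.2 := by
  have ha : Primrec fun a : Bool × ℕ × ℕ => a.2.1 := Primrec.fst.comp Primrec.snd
  have hd : Primrec fun a : Bool × ℕ × ℕ => a.2.2 := Primrec.snd.comp Primrec.snd
  have hd' := Primrec.nat_sub.comp hd (Primrec.const 1)
  have hd1 := Primrec.nat_add.comp hd (Primrec.const 1)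
  refine Primrec.ite (Primrec.eq.comp Primrec.fst (Primrec.const true)) ?_ ?_
  · exact Primrec.list_cons.comp (hd'.pair hd') (Primrec.list_cons.comp (ha.pair ha)
      (Primrec.list_cons.comp (hd.pair hd1) (Primrec.const [])))
  · exact Primrec.list_cons.comp (hd'.pair hd') (Primrec.list_cons.comp (hd.pair ha)
      (Primrec.list_cons.comp (hd1.pair hd1) (Primrec.const [])))

lemma primrec_compileNode : Primrec fun a : ℕ × (List (ℕ × Bool) × Bool) × Circuit =>
    compileNode a.1 a.2.1 a.2.2 := by
  have hC : Primrec fun a : ℕ × (List (ℕ × Bool) × Bool) × Circuit => a.2.2 :=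
    Primrec.snd.comp Primrec.snd
  have hp : Primrec fun a : ℕ × (List (ℕ × Bool) × Bool) × Circuit => a.2.1 :=
    Primrec.fst.comp Primrec.snd
  have hT : Primrec fun a : ℕ × (List (ℕ × Bool) × Bool) × Circuit =>
      compileTerm a.1 a.2.1.1 a.2.2 :=
    primrec_compileTerm.comp (Primrec.fst.pair ((Primrec.fst.comp hp).pair hC))
  refine Primrec.list_append.comp hT (primrec_selectGates.comp
    ((Primrec.snd.comp hp).pair (Primrec.pair ?_ ?_)))
  · exact Primrec.nat_sub.comp (Primrec.nat_add.comp Primrec.fst (Primrec.list_length.comp hC))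
      (Primrec.const 1)
  · exact Primrec.nat_add.comp Primrec.fst (Primrec.list_length.comp hT)

lemma primrec_compile : Primrec₂ compile := by
  refine Primrec.list_foldr (h := fun a s => compileNode a.1 s.1 s.2) Primrec.snd ?_ ?_
  · exact Primrec.list_cons.comp (Primrec.fst.pair Primrec.fst)
      (Primrec.list_cons.comp (Primrec.fst.pair Primrec.fst) (Primrec.const []))
  · exact primrec_compileNode.comp (Primrec.pair (Primrec.fst.comp Primrec.fst) Primrec.snd)

/-- The learner for `k`-decision lists. -/
def greedyLearner (k : ℕ) : Learner := fun a => compile a.1 (greedy k a.1 a.2)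

theorem computable_greedyLearner (k : ℕ) : Computable (greedyLearner k) :=
  (primrec_compile.comp Primrec.fst ((primrec_greedy k).comp Primrec.fst Primrec.snd)).to_comp

end Computability

/-! ### Robust learnability -/

lemma exists_two_pow_logBudget_le {b : ℝ} (hb : 1 < b) :
    ∃ e : ℕ, ∀ n : ℕ, (2 : ℝ) ^ logBudget b n ≤ ((n : ℝ) + 1) ^ e := by
  -- With `2 < b ^ e`, the power `2 ^ ⌊log_b n⌋` is at most `(b ^ ⌊log_b n⌋) ^ e`, hence at most `n
  -- ^ e` for `n ≥ 1`; the `n + 1` covers `n = 0`.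
  obtain ⟨e, he⟩ := pow_unbounded_of_one_lt (2 : ℝ) hb
  have hb0 : 0 < b := by linarith
  refine ⟨e, fun n => ?_⟩
  have hbn : b ^ logBudget b n ≤ (n : ℝ) + 1 := by
    rcases Nat.eq_zero_or_pos n with rfl | hn
    · simp [logBudget]
    · have hn' : (1 : ℝ) ≤ n := by exact_mod_cast hn
      have h1 : (logBudget b n : ℝ) ≤ Real.logb b n :=
        Nat.floor_le (Real.logb_nonneg hb hn')
      have h2 := (Real.le_logb_iff_rpow_le hb (by linarith)).1 h1
      rw [Real.rpow_natCast] at h2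
      linarith
  calc (2 : ℝ) ^ logBudget b n ≤ (b ^ e) ^ logBudget b n := by gcongr
    _ = (b ^ logBudget b n) ^ e := pow_right_comm _ _ _
    _ ≤ _ := by gcongr

lemma DecisionList.length_nodes_lt_size {n : ℕ} (L : DecisionList n) :
    L.nodes.length + 1 ≤ L.size := by
  have := List.length_le_sum_of_one_le (L.nodes.map fun p => p.1.card + 1) (by simp)
  rw [List.length_map] at this
  exact Nat.add_le_add_right this 1

lemma exists_list_of_mem_concepts {R : ∀ n, Set (DecisionList n)} {n : ℕ} {c : Cube n → Bool}
    (hc : c ∈ (ConceptClass.ofLists R).concepts n) :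
    ∃ L ∈ R n, L.eval = c ∧ L.size = (ConceptClass.ofLists R).size n c := by
  obtain ⟨L, hL, he⟩ := hc
  exact Nat.sInf_mem (s := {s | ∃ L ∈ R n, L.eval = c ∧ L.size = s}) ⟨L.size, L, hL, he, rfl⟩

/-- An upper bound for the number of terms with at most `k` literals, as a polynomial. -/
noncomputable def termsPoly (k : ℕ) : MvPolynomial (Fin 4) ℝ := (2 * MvPolynomial.X 0 + 1) ^ k

/-- An upper bound for the number of gates of a compiled `k`-decision list. -/
noncomputable def gatesPoly (k : ℕ) : MvPolynomial (Fin 4) ℝ := 2 + termsPoly k * (3 * k + 4)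

/-- An upper bound for the size of a compiled `k`-decision list. -/
noncomputable def circuitPoly (k : ℕ) : MvPolynomial (Fin 4) ℝ :=
  gatesPoly k * (1 + (MvPolynomial.X 0 + gatesPoly k) + (MvPolynomial.X 0 + gatesPoly k))

/-- The sample complexity for `k`-decision lists, where the robust risk is at most the `q`-th root
of the standard risk, up to the number of pairs of nodes and a factor `(n + 1) ^ e`. -/
noncomputable def samplePoly (k e q : ℕ) : MvPolynomial (Fin 4) ℝ :=
  (termsPoly k * (2 * termsPoly k) + MvPolynomial.X 2) *
    ((MvPolynomial.X 0 + 1) ^ e * ((termsPoly k + 1) * MvPolynomial.X 3) * MvPolynomial.X 1) ^ q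

section Poly

variable (k e q n : ℕ) (ε δ : ℝ) (s : ℕ)

lemma polyAt_circuitPoly : polyAt (circuitPoly k) n ε δ s =
    (2 + (2 * n + 1) ^ k * (3 * k + 4)) * (1 + (n + (2 + (2 * n + 1) ^ k * (3 * k + 4))) +
      (n + (2 + (2 * n + 1) ^ k * (3 * k + 4)))) := by
  simp [polyAt, circuitPoly, gatesPoly, termsPoly]

lemma polyAt_samplePoly : polyAt (samplePoly k e q) n ε δ s =
    ((2 * n + 1) ^ k * (2 * (2 * n + 1) ^ k) + 1 / δ) *
      ((n + 1) ^ e * (((2 * n + 1) ^ k + 1) * s) * (1 / ε)) ^ q := by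
  simp [polyAt, samplePoly, termsPoly]

end Poly

lemma size_greedyLearner_le (k n : ℕ) (S : List (List Bool × Bool)) (ε δ : ℝ) (s : ℕ) :
    ((greedyLearner k (n, S)).size : ℝ) ≤ polyAt (circuitPoly k) n ε δ s := by
  obtain ⟨h1, h2⟩ := compile_bounds (n := n) (k := k) (greedy k n S)
    fun p hp => mem_rawNodes.1 (mem_rawNodes_of_mem_greedy p hp)
  rw [length_greedy] at h2
  have h3 : (compile n (greedy k n S)).length ≤ 2 + (2 * n + 1) ^ k * (3 * k + 4) :=
    h2.trans (by gcongr; exact length_rawTerms_le k n)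
  have h4 := (Circuit.size_le h1).trans (Nat.mul_le_mul h3 (Nat.add_le_add
    (Nat.add_le_add_left (Nat.add_le_add_left h3 n) 1) (Nat.add_le_add_left h3 n)))
  rw [polyAt_circuitPoly]
  exact_mod_cast h4

/-- The greedy list always has `T = (rawTerms k n).length` nodes out of `2 * T`, so there are `(2 *
T) ^ T` candidates, independently of the target. -/
lemma log_card_nodeLists_le (k n : ℕ) :
    Real.log (Fintype.card (Fin (rawTerms k n).length → Fin (rawNodes k n).length)) ≤
      (2 * n + 1) ^ k * (2 * (2 * n + 1) ^ k) := by
  have hT : ((rawTerms k n).length : ℝ) ≤ (2 * n + 1) ^ k := by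
    exact_mod_cast length_rawTerms_le k n
  have h0 : (0 : ℝ) ≤ (rawTerms k n).length := Nat.cast_nonneg _
  rw [Fintype.card_fun, Fintype.card_fin, Fintype.card_fin, length_rawNodes]
  push_cast
  rw [Real.log_pow]
  have hlog : Real.log (2 * (rawTerms k n).length) ≤ 2 * (rawTerms k n).length :=
    Real.log_le_self (by positivity)
  calc ((rawTerms k n).length : ℝ) * Real.log (2 * (rawTerms k n).length)
      ≤ (rawTerms k n).length * (2 * (rawTerms k n).length) := by gcongr
    _ ≤ _ := by gcongr

lemma exists_eq_ofFn_of_mem {α : Type*} {N : ℕ} (L A : List α) (hL : L.length = N)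
    (hA : ∀ p ∈ L, p ∈ A) : ∃ f : Fin N → Fin A.length, L = List.ofFn fun i => A.get (f i) := by
  subst hL
  have : ∀ i : Fin L.length, ∃ j : Fin A.length, A.get j = L.get i :=
    fun i => List.mem_iff_get.1 (hA _ (List.get_mem L i))
  choose f hf using this
  refine ⟨f, ?_⟩
  simp only [hf]
  exact (List.ofFn_get L).symm

theorem greedyLearner_efficientlyRobustlyLearns {α : ℝ} (hα : 0 < α)
    {𝒟 : ∀ n : ℕ, Set (PMF (Cube n))} (h𝒟 : ∀ n : ℕ, ∀ D ∈ 𝒟 n, LogLipschitz α D)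
    {b : ℝ} (hb : 1 < b) {k : ℕ} {R : ∀ n, Set (DecisionList n)} (hR : ∀ n, ∀ L ∈ R n, L.IsK k) :
    EfficientlyRobustlyLearns (greedyLearner k) (ConceptClass.ofLists R) 𝒟 (logBudget b) := by
  obtain ⟨e, he⟩ := exists_two_pow_logBudget_le hb
  obtain ⟨q, hq⟩ := exists_pow_robustRisk_le hα k
  refine ⟨samplePoly k e q, circuitPoly k, fun n c hc D hD ε δ hε hδ m hm =>
    ⟨fun S => size_greedyLearner_le k n _ ε δ _, ?_⟩⟩
  obtain ⟨Lc, hLcR, rfl, hsize⟩ := exists_list_of_mem_concepts hc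
  rw [← hsize, polyAt_samplePoly] at hm
  have hk := hR n Lc hLcR
  set N : ℝ := (2 * n + 1) ^ k with hN
  have hN0 : 0 < N := by positivity
  have hs : (Lc.nodes.length : ℝ) + 1 ≤ Lc.size := by exact_mod_cast Lc.length_nodes_lt_size
  have hs0 : (0 : ℝ) < Lc.size := lt_of_lt_of_le (by positivity) hs
  -- `Q` dominates the loss `2 ^ ρ` times the number of pairs of regions. Hence robust risk at least
  -- `ε` forces standard risk at least `(ε / Q) ^ q`, which is the threshold `η` below.
  set Q : ℝ := (n + 1) ^ e * ((N + 1) * Lc.size) with hQ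
  have hQ0 : 0 < Q := by positivity
  refine lt_sampleMeasure_real_of_consistent D Lc.eval (η := (ε / Q) ^ q)
    (fun (f : Fin (rawTerms k n).length → Fin (rawNodes k n).length) x =>
      rawEval (List.ofFn fun i => (rawNodes k n).get (f i)) (List.ofFn x)) hδ ?_ ?_
  · refine (add_le_add_left (log_card_nodeLists_le k n) _).trans ?_
    refine le_trans (le_of_eq ?_) (mul_le_mul_of_nonneg_left hm (by positivity))
    -- The factor `(Q / ε) ^ q` of the sample size cancels against `η`.
    rw [mul_left_comm ((ε / Q) ^ q), ← mul_pow (ε / Q)]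
    have : ε / Q * (Q * (1 / ε)) = 1 := by field_simp
    rw [this, one_pow, mul_one]
  · intro S hS
    set h := greedy k n (labelled Lc.eval S) with hh
    have hmem : ∀ p ∈ h, p.1 ∈ rawTerms k n := fun p hp =>
      mem_rawNodes.1 (mem_rawNodes_of_mem_greedy p hp)
    have hvars : ∀ p ∈ h, ∀ l ∈ p.1, l.1 < n := fun p hp => (mem_rawTerms.1 (hmem p hp)).2
    obtain ⟨f, hf⟩ := exists_eq_ofFn_of_mem h (rawNodes k n) (length_greedy k n _)
      mem_rawNodes_of_mem_greedy
    refine ⟨f, fun j => ?_, ?_⟩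
    · simp only [← hf]
      exact rawEval_greedy_labelled hk Lc.last S j
    · simp only [← hf]
      set L := h.map fun p => (rawToTerm n p.1, p.2) with hL
      have hLlen : (L.length : ℝ) ≤ N := by
        rw [hL, List.length_map, hh, length_greedy, hN]
        exact_mod_cast length_rawTerms_le k n
      have hLk : ∀ p ∈ L, p.1.card ≤ k := by
        intro p hp
        obtain ⟨p', hp', rfl⟩ := List.mem_map.1 hp
        exact (card_rawToTerm_le p'.1).trans (mem_rawTerms.1 (hmem p' hp')).1
      have hrisk : ε ≤ robustRisk D (logBudget b n) (evalNodes L false) Lc.eval := by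
        have heval : (greedyLearner k (n, labelled Lc.eval S)).eval = evalNodes L false := by
          funext x
          rw [← rawEval_eq_evalNodes hvars x, ← eval_compile h hvars x]
          rfl
        rw [← heval]
        exact not_lt.1 hS
      have hbound := hq n D (h𝒟 n D hD) L Lc.nodes false Lc.last hLk hk (logBudget b n)
      have hset : {x : Cube n | rawEval h (List.ofFn x) ≠ Lc.eval x} =
          {x | evalNodes L false x ≠ evalNodes Lc.nodes Lc.last x} := by
        ext x
        rw [Set.mem_ofPred_eq, Set.mem_ofPred_eq, rawEval_eq_evalNodes hvars x]
        rfl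
      rw [hset]
      refine le_trans (pow_le_pow_left₀ (by positivity) ?_ q) hbound
      have hden : (2 : ℝ) ^ logBudget b n * ((L.length + 1) * (Lc.nodes.length + 1)) ≤ Q := by
        rw [hQ]
        gcongr
        exact he n
      exact div_le_div₀ (hε.le.trans hrisk) hrisk (by positivity) hden


end RobustDL

theorem mainTheorem5 (α : ℝ) (hα : 0 < α)
    (𝒟 : ∀ n : ℕ, Set (PMF (RobustDL.Cube n)))
    (h𝒟 : ∀ n : ℕ, ∀ D ∈ 𝒟 n, RobustDL.LogLipschitz α D)
    (b : ℝ) (hb : 1 < b) :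
    RobustDL.EfficientlyRobustlyLearnable (RobustDL.kDL 2) 𝒟 (RobustDL.logBudget b) ∧
      ∀ k : ℕ,
        RobustDL.EfficientlyRobustlyLearnable (RobustDL.monotoneKDL k) 𝒟
          (RobustDL.logBudget b) :=
  ⟨⟨RobustDL.greedyLearner 2, RobustDL.computable_greedyLearner 2,
    RobustDL.greedyLearner_efficientlyRobustlyLearns hα h𝒟 hb fun _ _ hL => hL⟩,
  fun k => ⟨RobustDL.greedyLearner k, RobustDL.computable_greedyLearner k,
    RobustDL.greedyLearner_efficientlyRobustlyLearns hα h𝒟 hb fun _ _ hL => hL.1⟩⟩
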